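/- **Setting.** Let $G$ be a simple graph on $\{1,\dots,n\}$ with positive degrees $d_i$ and adjacency matrix $A=(a_{ij})$. Let $B=(a_{ij}/d_i)$ be the transition matrix of the random walk, $W=\frac12 I+\frac12 B$, and $\tilde W=W-\frac1n J$, where $J$ is the all-ones matrix. For a diagonalizable matrix $M$ with real spectrum, $\lambda_1(M)\ge\dots\ge\lambda_n(M)$ are its eigenvalues with multiplicity and $\mathbf v_1(M),\dots,\mathbf v_n(M)$ is a basis of corresponding eigenvectors of Euclidean norm $1$ (not necessarily orthogonal). **Algorithm** (privacy budget $\epsilon>0$, $g>1$, number of iterations $T=\frac{2\log n}{\log g}$ rounded up or down to an integer, clipping factor $\mathsf c\in(0,\infty]$). Node $i$ publishes $\tilde d_i=d_i+\mathrm{Lap}(10/\epsilon)$, where $\mathrm{Lap}(b)$ is the centred Laplace law of scale $b$. Put $\delta=\min_i\tilde d_i-\frac{10}{\epsilon}\log\frac{n^2}{2}$. As long as its adjacency list has fewer than $\delta$ elements, node $i$ adds to it a uniformly random node that is not in the list; let $N_i$ be the final list. The vector $\mathbf x^{(0)}$ has independent standard Gaussian entries. For $t=1,\dots,T$ put $C_t=\frac{5T}{9\epsilon}\cdot\frac{\max_j|x^{(t-1)}_j|}{\delta}$,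 let $y^{(t)}_i$ be a $\mathrm{Lap}(C_t)$ variable, let $$w^{(t)}_i=\tfrac12x^{(t-1)}_i+\tfrac12\sum_{j\in N_i}\frac{x^{(t-1)}_j}{|N_i|}-\frac1n\sum_jx^{(t-1)}_j+y^{(t)}_i ,$$ and let $x^{(t)}_i$ be $w^{(t)}_i$ clipped to $[-\mathsf cC_t,\mathsf cC_t]$ (not clipped if $\mathsf c=\infty$). All random choices are independent (the noise of iteration $t$ conditionally on $C_t$). Fix a basis $\mathbf v_j=\mathbf v_j(\tilde W)=(v_{j,1},\dots,v_{j,n})$ as above, write $\lambda_j=\lambda_j(\tilde W)$, $\mathbf x^{(0)}=\sum_jc_j\mathbf v_j$, $\mathbf y^{(t)}=\sum_je^{(t)}_j\mathbf v_j$, and $\tilde c_j=c_j\lambda_j^T+\sum_{t=1}^Te^{(t)}_j\lambda_j^{T-t}$. **Theorem.** Let $\epsilon>0$, $g>1$, $\gamma\in(0,1)$ and $\rho\in(0,1]$ be constants. There are a constant $C$ and a function $r(n)=o(1)$, depending only on $\epsilon,g,\gamma,\rho$, such that the following holds for every $n\ge C$, every graph $G$ on $n$ nodes, every clipping factor $\mathsf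 c\in[n,\infty]$ and every choice of the eigenvectors, provided $\tilde W$ is diagonalizable. Assume 1. every degree is at least $2\sqrt n\log^4n$; 2. $\lambda_i(B)+1\le\frac{\lambda_2(B)+1}{g}$ for all $i\ge3$; 3. at least $\rho n$ entries $\nu_i$ of $\mathbf v_2(B)$ satisfy $|\nu_i|\ge\gamma/\sqrt n$. Then for every node $i$ with $|v_{1,i}|\ge\gamma/\sqrt n$, with probability at least $0.95-r(n)$ the following hold together: $$\Big|c_1\lambda_1^Tv_{1,i}\Big|>\Big|\sum_{t=1}^Te_1^{(t)}\lambda_1^{T-t}v_{1,i}+\sum_{j=2}^n\tilde c_jv_{j,i}\Big|,\qquad x^{(T)}_i=\sum_{j=1}^n\tilde c_jv_{j,i},\qquad \operatorname{sign}x_i^{(T)}=\operatorname{sign}(c_1)\operatorname{sign}(v_{1,i}).$$ Thus, up to the global flip $\operatorname{sign}(c_1)$, the sign of $x^{(T)}_i$ is that of $v_{1,i}$. Moreover, $\mathbf v_1(\tilde W)=\pm\mathbf v_2(B)$ whenever the entries of $\mathbf v_2(B)$ sum to zero (for instance if $G$ is regular and connected), and then this is the sign used by spectral clustering. -/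

import Mathlib

open MeasureTheory ProbabilityTheory Filter Topology

noncomputable section

namespace PrivatePIC

/-- The Laplace distribution `Lap(b)` with mean `0` and scale `b > 0`: the measure on `ℝ` with
density `x ↦ exp (-|x| / b) / (2 b)`. -/
def laplace (b : ℝ) : Measure ℝ :=
  volume.withDensity fun x => ENNReal.ofReal (Real.exp (-|x| / b) / (2 * b))

/-! ### Graphs, matrices and eigenvectors -/

section Matrices

variable {n : ℕ}

open Classical in
/-- The transition matrix `B` of the simple random walk: `B i j = a i j / d i`. -/
def transitionMatrix (G : SimpleGraph (Fin n)) : Matrix (Fin n) (Fin n) ℝ :=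
  Matrix.of fun i j => G.adjMatrix ℝ i j / (G.degree i : ℝ)

/-- The lazy random walk matrix `W = I/2 + B/2`. -/
def lazyMatrix (G : SimpleGraph (Fin n)) : Matrix (Fin n) (Fin n) ℝ :=
  (1 / 2 : ℝ) • (1 : Matrix (Fin n) (Fin n) ℝ) + (1 / 2 : ℝ) • transitionMatrix G

/-- The matrix `W̃`, with entries `W i j - 1/n`. -/
def deflatedMatrix (G : SimpleGraph (Fin n)) : Matrix (Fin n) (Fin n) ℝ :=
  Matrix.of fun i j => lazyMatrix G i j - 1 / (n : ℝ)

/-- `μ 0 ≥ μ 1 ≥ ⋯` are the eigenvalues of `A`, listed with multiplicity, and `v 0, v 1, …` is a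
basis of `ℝⁿ` consisting of corresponding eigenvectors of Euclidean norm `1`.  The matrix need not
be symmetric, and the basis need not be orthogonal.  Indices start at `0`, so `μ 0` is the largest
eigenvalue. -/
structure IsEigenbasis (A : Matrix (Fin n) (Fin n) ℝ) (μ : Fin n → ℝ)
    (v : Module.Basis (Fin n) ℝ (Fin n → ℝ)) : Prop where
  antitone : Antitone μ
  eigen : ∀ j, A.mulVec (v j) = μ j • v j
  unit : ∀ j, ∑ k, v j k ^ 2 = 1

end Matrices

/-! ### The algorithm -/

instance permMeasurableSpace (n : ℕ) : MeasurableSpace (Equiv.Perm (Fin n)) := ⊤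

/-- The randomness used by `T` iterations of the algorithm on `n` nodes:
* the noise `ℓ i` that node `i` adds to its degree;
* the random order in which node `i` goes through the nodes when it has to add edges;
* the initial vector `x⁽⁰⁾`;
* standard Laplace variables `Z t i`; the `Lap(b)` noise of node `i` in iteration `t + 1` is
  `b * Z t i`. -/
abbrev Sample (n T : ℕ) : Type :=
  (Fin n → ℝ) × (Fin n → Equiv.Perm (Fin n)) × (Fin n → ℝ) × (Fin T → Fin n → ℝ)

/-- The law of the randomness: all coordinates are independent, the degree noise is `Lap(10/ε)`,
the orders are uniformly distributed, the entries of `x⁽⁰⁾` are standard Gaussian. -/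
def sampleLaw (ε : ℝ) (n T : ℕ) : Measure (Sample n T) :=
  (Measure.pi fun _ : Fin n => laplace (10 / ε)).prod
    ((Measure.pi fun _ : Fin n => (PMF.uniformOfFintype (Equiv.Perm (Fin n))).toMeasure).prod
      ((Measure.pi fun _ : Fin n => gaussianReal 0 1).prod
        (Measure.pi fun _ : Fin T => Measure.pi fun _ : Fin n => laplace 1)))

section Algorithm

variable {n T : ℕ} (G : SimpleGraph (Fin n)) (ε : ℝ) (c : WithTop ℝ) (ω : Sample n T)

open Classical in
/-- The noisy estimate `δ = min_i (d i + ℓ i) - (10/ε) log (n / (2ζ))` of the minimum degree,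
where `ζ = 1/n`. -/
def degreeEstimate : ℝ :=
  (⨅ i : Fin n, ((G.degree i : ℝ) + ω.1 i))
    - 10 / ε * Real.log ((n : ℝ) / (2 * (1 / (n : ℝ))))

open Classical in
/-- The adjacency list of node `i` after it has been enlarged to at least `δ` elements: as long as
the list has fewer than `δ` elements, the next node (in the random order of `i`) that is not yet in
the list is added.  The list is unchanged if `δ ≤ d i`. -/
def adjacencyList (i : Fin n) : Finset (Fin n) :=
  ((List.finRange n).map (ω.2.1 i)).foldl
    (fun s j => if (s.card : ℝ) < degreeEstimate G ε ω then insert j s else s)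
    (G.neighborFinset i)

/-- The scale `(5 T / (9 ε)) * max_j |x j| / δ` of the Laplace noise added to the image of `x`. -/
def noiseScale (x : Fin n → ℝ) : ℝ :=
  5 * (T : ℝ) / (9 * ε) * ((⨆ j : Fin n, |x j|) / degreeEstimate G ε ω)

/-- Clipping of `w` to `[-U, U]`, where `U = c * b`; the clipping factor `c = ⊤` means that
nothing is clipped. -/
def clip (c : WithTop ℝ) (b w : ℝ) : ℝ :=
  match c with
  | ⊤ => w
  | WithTop.some c => if c * b < w then c * b else if w < -(c * b) then -(c * b) else w

/-- The vectors `x⁽⁰⁾, x⁽¹⁾, …, x⁽ᵀ⁾` computed by the algorithm (constant after iteration `T`). -/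
def iterates : ℕ → Fin n → ℝ
  | 0 => ω.2.2.1
  | t + 1 => fun i =>
      if h : t < T then
        clip c (noiseScale G ε ω (iterates t))
          (1 / 2 * iterates t i
            + 1 / 2 * ∑ j ∈ adjacencyList G ε ω i,
                iterates t j / ((adjacencyList G ε ω i).card : ℝ)
            - 1 / (n : ℝ) * ∑ j, iterates t j
            + noiseScale G ε ω (iterates t) * ω.2.2.2 ⟨t, h⟩ i)
      else iterates t i

/-- The Laplace noise vector `y⁽ᵗ⁺¹⁾` added in iteration `t + 1`. -/
def noise (t : Fin T) (i : Fin n) : ℝ :=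
  noiseScale G ε ω (iterates G ε c ω t) * ω.2.2.2 t i

variable (μ : Fin n → ℝ) (v : Module.Basis (Fin n) ℝ (Fin n → ℝ))

/-- The coefficient `c_j` of `x⁽⁰⁾` along `v j`. -/
def initCoeff (j : Fin n) : ℝ := v.repr ω.2.2.1 j

/-- The accumulated noise `∑_{s=1}^T e_j⁽ˢ⁾ (μ j)^(T-s)` along `v j`, where `e_j⁽ˢ⁾` is the
coefficient of `y⁽ˢ⁾` along `v j` (here `s = t + 1`). -/
def noiseCoeff (j : Fin n) : ℝ :=
  ∑ t : Fin T, v.repr (noise G ε c ω t) j * μ j ^ (T - ((t : ℕ) + 1))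

/-- `c̃_j = c_j (μ j)^T + ∑_{s=1}^T e_j⁽ˢ⁾ (μ j)^(T-s)`. -/
def finalCoeff (j : Fin n) : ℝ :=
  initCoeff ω v j * μ j ^ T + noiseCoeff G ε c ω μ v j

end Algorithm

end PrivatePIC

end

/-! If no adjacency list is enlarged and nothing is clipped, the algorithm is the recursion `x (t+1)
= D x t + C t • Z t` with `D = deflatedMatrix G`. Its solution is `D ^ T x 0` plus the sum of `C t •
D ^ (T-t-1) (Z t)`. The quantities in the theorem sum over a possibly ill-conditioned eigenbasis,
but such a sum over all `j` is an entry of a power of `D` applied to a vector. So only `v 0`, its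
coordinate functional and the rows of `D ^ k` have to be controlled.

Spectral part. `D` is not symmetric, but the lazy walk `W` is self-adjoint for the weights `d`, and
`D 1 = 0` gives `D ^ (k+1) = D * W ^ k`. The coordinate functional of `v 0` is represented by an
eigenvector `dualVec` of `W`, orthogonal to `1`, with eigenvalue `μ 0 = (κ 1 + 1) / 2`. On the
weighted complement of `1` and `dualVec`, `W` contracts by `μ 0 / s ^ 2`, where `s = √g`. Entrywise
bounds follow because `B` maps weighted `ℓ²` to `ℓ^∞`: degrees of at least `√n` compensate exactly
for weights of at most `n`. The identity part of `W` only contracts by `1/2`, but `B` has trace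
zero, which forces `s ≤ 2 * μ 0` and hence `1/2 ≤ μ 0 / s`. Altogether `D ^ k` is its rank-one
leading term up to an error of order `k * (μ 0 / s) ^ k`, and its rows have norm at most `rowBound s
* μ 0 ^ k` (`abs_deflatedOf_pow_sub_le`, `abs_deflatedOf_pow_le`).

Probabilistic part, with `L = log n`. The coefficient of `x 0` along `v 0` is a centred Gaussian of
standard deviation at least `1`, so with probability `0.95` it exceeds `1/20`, and the signal at
node `i` exceeds `γ / (20 √n)`. Since `s ^ (T+1) ≥ n`, the other directions of `x 0` contribute `O(L
^ 2 / n)`. The iterates stay of order `L * μ 0 ^ t` (`abs_le_of_recursion`), so the noise scales are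
bounded deterministically on a good event, and no conditioning on the past is needed. Chebyshev with
threshold `η * L` in each of the `O(L)` iterations bounds the noise at `i` by a small constant times
`1 / √n`; the factor `L ^ 4` in the minimum degree makes this balance. `IsGapped.run` is the
deterministic core, and `IsGapped.le_sampleLaw_real` is the union bound. -/

namespace PrivatePIC

/-! ### The Laplace distribution -/

lemma integrable_comp_abs {f : ℝ → ℝ} (hf : IntegrableOn f (Set.Ioi 0)) :
    Integrable fun x : ℝ => f |x| := by
  have h := (integrable_fun_norm_addHaar (volume : Measure ℝ) (f := f)).2 (by simpa using hf)
  simpa [Real.norm_eq_abs] using h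

lemma integrableOn_exp_neg_div {b : ℝ} (hb : 0 < b) (c : ℝ) :
    IntegrableOn (fun x : ℝ => Real.exp (-x / b) / (2 * b)) (Set.Ioi c) := by
  have h := (integrableOn_exp_mul_Ioi (a := -(1 / b)) (by simpa using hb) c).div_const (2 * b)
  refine IntegrableOn.congr_fun h (fun x _ => ?_) measurableSet_Ioi
  show Real.exp (-(1 / b) * x) / (2 * b) = _
  congr 2
  ring

lemma integral_exp_neg_div {b : ℝ} (hb : 0 < b) (c : ℝ) :
    ∫ x in Set.Ioi c, Real.exp (-x / b) / (2 * b) = Real.exp (-c / b) / 2 := by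
  have h : ∀ x : ℝ, Real.exp (-x / b) / (2 * b) = Real.exp (-(1 / b) * x) / (2 * b) := by
    intro x
    congr 2
    ring
  simp_rw [h]
  rw [integral_div, integral_exp_mul_Ioi (by simpa using hb)]
  have : -(1 / b) * c = -c / b := by ring
  rw [this]
  field_simp

/-- Folding the line at the origin leaves a one-sided exponential integral. The case `s = 0` gives
the total mass, and positive `s` controls the degree noise. -/
lemma laplace_abs_gt {b : ℝ} (hb : 0 < b) {s : ℝ} (hs : 0 ≤ s) :
    laplace b {x | s < |x|} = ENNReal.ofReal (Real.exp (-s / b)) := by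
  have hms : MeasurableSet {x : ℝ | s < |x|} := measurableSet_lt measurable_const measurable_id.abs
  have hint : Integrable fun x : ℝ => (Set.Ioi s).indicator
      (fun x => Real.exp (-x / b) / (2 * b)) |x| :=
    integrable_comp_abs (((integrable_indicator_iff measurableSet_Ioi).2
      (integrableOn_exp_neg_div hb s)).integrableOn)
  have hind : ∀ x : ℝ, {x : ℝ | s < |x|}.indicator
      (fun x => ENNReal.ofReal (Real.exp (-|x| / b) / (2 * b))) x =
      ENNReal.ofReal ((Set.Ioi s).indicator (fun x => Real.exp (-x / b) / (2 * b)) |x|) := by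
    intro x
    by_cases h : s < |x| <;> simp [Set.indicator, h]
  have hI : (Set.Ioi (0 : ℝ)) ∩ Set.Ioi s = Set.Ioi s := by
    rw [Set.Ioi_inter_Ioi, max_eq_right hs]
  rw [laplace, withDensity_apply _ hms, ← lintegral_indicator hms]
  simp_rw [hind]
  rw [← ofReal_integral_eq_lintegral_ofReal hint
    (ae_of_all _ fun x => Set.indicator_nonneg (fun _ _ => by positivity) _),
    integral_comp_abs (f := (Set.Ioi s).indicator fun x => Real.exp (-x / b) / (2 * b)),
    setIntegral_indicator measurableSet_Ioi, hI, integral_exp_neg_div hb]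
  congr 1
  ring

lemma isProbabilityMeasure_laplace {b : ℝ} (hb : 0 < b) : IsProbabilityMeasure (laplace b) := by
  constructor
  have h := laplace_abs_gt hb le_rfl
  have hac : laplace b {(0 : ℝ)} = 0 :=
    (withDensity_absolutelyContinuous volume _) Real.volume_singleton
  have hu : (Set.univ : Set ℝ) = {x | 0 < |x|} ∪ {0} := by
    ext x
    by_cases hx : x = 0 <;> simp [hx]
  refine le_antisymm ?_ ?_
  · rw [hu]
    refine (measure_union_le _ _).trans ?_
    rw [h, hac]
    simp
  · calc (1 : ENNReal) = laplace b {x | 0 < |x|} := by rw [h]; simp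
      _ ≤ _ := measure_mono (Set.subset_univ _)

instance isProbabilityMeasure_laplace_one : IsProbabilityMeasure (laplace 1) :=
  isProbabilityMeasure_laplace one_pos

lemma integral_laplace_one (f : ℝ → ℝ) :
    ∫ x, f x ∂(laplace 1) = ∫ x, Real.exp (-|x|) / 2 * f x := by
  rw [laplace, integral_withDensity_eq_integral_toReal_smul (by fun_prop) (by simp)]
  refine integral_congr_ae (ae_of_all _ fun x => ?_)
  simp only [div_one, mul_one, smul_eq_mul]
  rw [ENNReal.toReal_ofReal (by positivity)]

lemma memLp_id_laplace_one : MemLp id 2 (laplace 1) := by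
  rw [memLp_two_iff_integrable_sq measurable_id.aestronglyMeasurable, laplace,
    integrable_withDensity_iff_integrable_smul' (by fun_prop) (by simp)]
  have h : IntegrableOn (fun x : ℝ => Real.exp (-x) / 2 * x ^ 2) (Set.Ioi 0) := by
    have := (Real.GammaIntegral_convergent (s := 3) (by norm_num)).div_const 2
    refine IntegrableOn.congr_fun this (fun x _ => ?_) measurableSet_Ioi
    have : x ^ ((3 : ℝ) - 1) = x ^ 2 := by
      rw [← Real.rpow_natCast]; norm_num
    simp only [this]
    ring
  refine (integrable_comp_abs h).congr (ae_of_all _ fun x => ?_)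
  simp only [id, div_one, mul_one, smul_eq_mul, sq_abs]
  rw [ENNReal.toReal_ofReal (by positivity)]

lemma integral_id_laplace_one : ∫ x, x ∂(laplace 1) = 0 := by
  rw [integral_laplace_one]
  have h := integral_neg_eq_self (fun x : ℝ => Real.exp (-|x|) / 2 * x) volume
  simp only [abs_neg, mul_neg, integral_neg] at h
  linarith

lemma integral_sq_laplace_one : ∫ x, x ^ 2 ∂(laplace 1) = 2 := by
  rw [integral_laplace_one]
  have h := integral_comp_abs (f := fun x => Real.exp (-x) / 2 * x ^ 2)
  simp only [sq_abs] at h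
  rw [h]
  have h2 := Real.integral_rpow_mul_exp_neg_mul_Ioi (a := 3) (r := 1) (by norm_num) one_pos
  have h3 : Real.Gamma 3 = 2 := by
    have : (3 : ℝ) = ((2 : ℕ) : ℝ) + 1 := by norm_num
    rw [this, Real.Gamma_nat_eq_factorial]
    norm_num [Nat.factorial]
  rw [h3] at h2
  have h4 : ∫ x in Set.Ioi (0 : ℝ), Real.exp (-x) / 2 * x ^ 2 =
      ∫ x in Set.Ioi (0 : ℝ), (x ^ ((3 : ℝ) - 1) * Real.exp (-(1 * x))) / 2 := by
    refine setIntegral_congr_fun measurableSet_Ioi fun x _ => ?_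
    have : x ^ ((3 : ℝ) - 1) = x ^ 2 := by
      rw [← Real.rpow_natCast]; norm_num
    simp only [this, one_mul]
    ring
  rw [h4, integral_div, h2]
  norm_num

lemma variance_id_laplace_one : Var[id; laplace 1] = 2 := by
  rw [variance_of_integral_eq_zero measurable_id.aemeasurable (by simpa using integral_id_laplace_one)]
  simpa using integral_sq_laplace_one

/-! ### Linear forms in independent variables -/

section LinearForms

variable {n : ℕ}

/-- Chebyshev's inequality for a linear form in standard Laplace variables. -/
lemma pi_laplace_linear_ge (a : Fin n → ℝ) {u : ℝ} (hu : 0 < u) :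
    Measure.pi (fun _ : Fin n => laplace 1) {z | u ≤ |∑ k, a k * z k|}
      ≤ ENNReal.ofReal (2 * (∑ k, a k ^ 2) / u ^ 2) := by
  have hm : ∀ i, MemLp (fun x : ℝ => a i * id x) 2 (laplace 1) :=
    fun i => memLp_id_laplace_one.const_mul (a i)
  have hm' : ∀ i, MemLp (fun z : Fin n → ℝ => a i * z i) 2
      (Measure.pi fun _ : Fin n => laplace 1) := fun i =>
    (hm i).comp_measurePreserving (measurePreserving_eval (fun _ : Fin n => laplace 1) i)
  have hs : MemLp (∑ i, fun z : Fin n → ℝ => a i * z i) 2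
      (Measure.pi fun _ : Fin n => laplace 1) := memLp_finsetSum' _ fun i _ => hm' i
  have hv := variance_sum_pi hm
  have h0 : ∫ z, (∑ i, fun z : Fin n → ℝ => a i * z i) z
      ∂(Measure.pi fun _ : Fin n => laplace 1) = 0 := by
    simp only [Finset.sum_apply]
    rw [integral_finsetSum _ fun i _ => (hm' i).integrable (by norm_num)]
    refine Finset.sum_eq_zero fun i _ => ?_
    rw [integral_const_mul]
    have := integral_comp_eval (μ := fun _ : Fin n => laplace 1) (i := i) (f := fun x : ℝ => x)
      measurable_id.aestronglyMeasurable
    rw [this, integral_id_laplace_one, mul_zero]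
  have h := meas_ge_le_variance_div_sq hs hu
  rw [h0] at h
  simp only [sub_zero, Finset.sum_apply] at h
  refine h.trans (le_of_eq ?_)
  congr 2
  refine hv.trans ?_
  rw [Finset.mul_sum]
  refine Finset.sum_congr rfl fun i _ => ?_
  rw [variance_const_mul, variance_id_laplace_one, mul_comm]

/-- Markov's inequality for the squared Euclidean norm of a vector of standard Laplace
variables. -/
lemma pi_laplace_sq_ge {R : ℝ} (hR : 0 < R) :
    Measure.pi (fun _ : Fin n => laplace 1) {z | R ≤ ∑ k, z k ^ 2}
      ≤ ENNReal.ofReal (2 * n / R) := by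
  have hm : ∀ i, Integrable (fun z : Fin n → ℝ => z i ^ 2)
      (Measure.pi fun _ : Fin n => laplace 1) := fun i =>
    (memLp_id_laplace_one.comp_measurePreserving
      (measurePreserving_eval (fun _ : Fin n => laplace 1) i)).integrable_sq
  have h := mul_meas_ge_le_integral_of_nonneg (μ := Measure.pi fun _ : Fin n => laplace 1)
    (f := fun z => ∑ k, z k ^ 2)
    (ae_of_all _ fun z => Finset.sum_nonneg fun k _ => sq_nonneg (z k))
    (integrable_finsetSum _ fun i _ => hm i) R
  rw [integral_finsetSum _ fun i _ => hm i] at h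
  have h1 : ∀ i : Fin n, ∫ z : Fin n → ℝ, z i ^ 2 ∂(Measure.pi fun _ : Fin n => laplace 1) = 2 := by
    intro i
    have := integral_comp_eval (μ := fun _ : Fin n => laplace 1) (i := i)
      (f := fun x : ℝ => x ^ 2) (by fun_prop)
    rw [this, integral_sq_laplace_one]
  simp only [h1, Finset.sum_const, Finset.card_univ, Fintype.card_fin, nsmul_eq_mul] at h
  rw [← ofReal_measureReal]
  refine ENNReal.ofReal_le_ofReal ?_
  rw [le_div_iff₀ hR]
  linarith

/-- A linear form in standard Gaussian variables is Gaussian. -/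
lemma map_pi_gaussian_linear (a : Fin n → ℝ) :
    (Measure.pi fun _ : Fin n => gaussianReal 0 1).map (fun x => ∑ k, a k * x k)
      = gaussianReal 0 (∑ k, a k ^ 2).toNNReal := by
  have hmeas : AEMeasurable (fun x : Fin n → ℝ => ∑ k, a k * x k)
      (Measure.pi fun _ : Fin n => gaussianReal 0 1) :=
    Measurable.aemeasurable (by fun_prop)
  have := Measure.isProbabilityMeasure_map hmeas
  refine Measure.ext_of_charFun ?_
  ext t
  rw [charFun_apply_real, integral_map hmeas (by fun_prop), charFun_gaussianReal]
  have h : ∀ x : Fin n → ℝ, Complex.exp (t * ((∑ k, a k * x k : ℝ) : ℂ) * Complex.I)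
      = ∏ k, Complex.exp (((t * a k : ℝ) : ℂ) * (x k : ℂ) * Complex.I) := by
    intro x
    rw [← Complex.exp_sum]
    congr 1
    push_cast
    rw [Finset.mul_sum, Finset.sum_mul]
    refine Finset.sum_congr rfl fun k _ => by ring
  simp_rw [h]
  rw [integral_fintype_prod_eq_prod
    (f := fun k (x : ℝ) => Complex.exp (((t * a k : ℝ) : ℂ) * (x : ℂ) * Complex.I))]
  simp_rw [← charFun_apply_real, charFun_gaussianReal]
  rw [← Complex.exp_sum]
  congr 1
  rw [Real.coe_toNNReal _ (Finset.sum_nonneg fun k _ => sq_nonneg (a k))]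
  push_cast
  rw [Finset.sum_mul, Finset.sum_div, mul_zero, zero_mul, zero_sub, ← Finset.sum_neg_distrib]
  refine Finset.sum_congr rfl fun k _ => ?_
  ring

lemma exp_half_le_two : Real.exp (1 / 2) ≤ 2 := by
  have h : Real.exp (1 / 2) ^ 2 ≤ 2 ^ 2 := by
    rw [← Real.exp_nat_mul]
    have := Real.exp_one_lt_d9
    norm_num
    linarith
  exact le_of_sq_le_sq h (by norm_num)

/-- Tail bound for a linear form in standard Gaussian variables. -/
lemma pi_gaussian_linear_ge (a : Fin n → ℝ) {σ : ℝ} (hσ : 0 < σ) (ha : ∑ k, a k ^ 2 ≤ σ ^ 2)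
    (u : ℝ) :
    Measure.pi (fun _ : Fin n => gaussianReal 0 1) {x | σ * u ≤ |∑ k, a k * x k|}
      ≤ ENNReal.ofReal (4 * Real.exp (-u)) := by
  have hs0 : 0 ≤ ∑ k, a k ^ 2 := Finset.sum_nonneg fun k _ => sq_nonneg (a k)
  have hmeas : Measurable (fun x : Fin n → ℝ => ∑ k, a k * x k) := by fun_prop
  have hset : MeasurableSet {y : ℝ | σ * u ≤ |y|} :=
    measurableSet_le measurable_const measurable_id.abs
  have h1 : Measure.pi (fun _ : Fin n => gaussianReal 0 1) {x | σ * u ≤ |∑ k, a k * x k|}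
      = gaussianReal 0 (∑ k, a k ^ 2).toNNReal {y : ℝ | σ * u ≤ |y|} := by
    rw [← map_pi_gaussian_linear, Measure.map_apply hmeas hset]
    rfl
  rw [h1, ← ofReal_measureReal]
  refine ENNReal.ofReal_le_ofReal ?_
  -- Chernoff's bound at `t = ±1/σ`: the moment generating function is at most `exp (1/2) ≤ 2`, so
  -- each side contributes `2 * exp (-u)`. A Gaussian rate is not needed.
  have key : ∀ t : ℝ, |t| = 1 / σ →
      Real.exp (-(1 / σ) * (σ * u)) * mgf id (gaussianReal 0 (∑ k, a k ^ 2).toNNReal) t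
        ≤ 2 * Real.exp (-u) := by
    intro t ht
    rw [mgf_id_gaussianReal, Real.coe_toNNReal _ hs0]
    have e1 : -(1 / σ) * (σ * u) = -u := by field_simp
    have e2 : Real.exp (0 * t + (∑ k, a k ^ 2) * t ^ 2 / 2) ≤ 2 := by
      refine le_trans (Real.exp_le_exp.2 ?_) exp_half_le_two
      have : t ^ 2 = (1 / σ) ^ 2 := by rw [← ht, sq_abs]
      rw [this, zero_mul, zero_add]
      have : (∑ k, a k ^ 2) * (1 / σ) ^ 2 ≤ σ ^ 2 * (1 / σ) ^ 2 :=
        mul_le_mul_of_nonneg_right ha (by positivity)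
      have e : σ ^ 2 * (1 / σ) ^ 2 = 1 := by field_simp
      linarith
    rw [e1, mul_comm]
    exact mul_le_mul_of_nonneg_right e2 (Real.exp_pos _).le
  have hsub : {y : ℝ | σ * u ≤ |y|} ⊆ {y | σ * u ≤ id y} ∪ {y | id y ≤ -(σ * u)} := by
    intro y hy
    rcases le_abs.1 (show σ * u ≤ |y| from hy) with h | h
    · exact Or.inl h
    · exact Or.inr (by simpa using (by linarith : y ≤ -(σ * u)))
  have hp := measure_ge_le_exp_mul_mgf (μ := gaussianReal 0 (∑ k, a k ^ 2).toNNReal) (X := id)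
    (t := 1 / σ) (σ * u) (by positivity) (integrable_exp_mul_gaussianReal _)
  have hn := measure_le_le_exp_mul_mgf (μ := gaussianReal 0 (∑ k, a k ^ 2).toNNReal) (X := id)
    (t := -(1 / σ)) (-(σ * u)) (by simpa using hσ.le) (integrable_exp_mul_gaussianReal _)
  have k1 := key (1 / σ) (abs_of_pos (by positivity))
  have k2 := key (-(1 / σ)) (by rw [abs_neg]; exact abs_of_pos (by positivity))
  have e3 : -(-(1 / σ)) * -(σ * u) = -(1 / σ) * (σ * u) := by ring
  rw [e3] at hn
  calc _ ≤ (gaussianReal 0 (∑ k, a k ^ 2).toNNReal).real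
        ({y | σ * u ≤ id y} ∪ {y | id y ≤ -(σ * u)}) := measureReal_mono hsub
    _ ≤ _ := measureReal_union_le _ _
    _ ≤ _ := by linarith

/-- Anti-concentration of a linear form in standard Gaussian variables. -/
lemma pi_gaussian_linear_le (a : Fin n → ℝ) (ha : 0 < ∑ k, a k ^ 2) :
    Measure.pi (fun _ : Fin n => gaussianReal 0 1)
        {x | |∑ k, a k * x k| ≤ √(∑ k, a k ^ 2) / 20}
      ≤ ENNReal.ofReal 0.05 := by
  set s := ∑ k, a k ^ 2 with hs
  have hmeas : Measurable (fun x : Fin n → ℝ => ∑ k, a k * x k) := by fun_prop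
  have hsq : 0 < √s := Real.sqrt_pos.2 ha
  have hset : {y : ℝ | |y| ≤ √s / 20} = Set.Icc (-(√s / 20)) (√s / 20) := by
    ext y; simp [abs_le]
  have h1 : Measure.pi (fun _ : Fin n => gaussianReal 0 1) {x | |∑ k, a k * x k| ≤ √s / 20}
      = gaussianReal 0 s.toNNReal (Set.Icc (-(√s / 20)) (√s / 20)) := by
    rw [← map_pi_gaussian_linear, Measure.map_apply hmeas measurableSet_Icc, ← hset]
    rfl
  have hne : s.toNNReal ≠ 0 := by simpa using ha
  rw [h1, gaussianReal_apply 0 hne]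
  -- The density is at most `1 / (2√s)` because `2π ≥ 4`, and the interval has length `√s / 10`.
  calc _ ≤ ∫⁻ _ in Set.Icc (-(√s / 20)) (√s / 20), ENNReal.ofReal (1 / (2 * √s)) := by
        refine lintegral_mono fun x => ENNReal.ofReal_le_ofReal ?_
        rw [gaussianPDFReal_def, Real.coe_toNNReal _ ha.le]
        have hpi : 2 * √s ≤ √(2 * Real.pi * s) := by
          rw [Real.sqrt_mul (by positivity)]
          refine mul_le_mul_of_nonneg_right ?_ hsq.le
          refine Real.le_sqrt_of_sq_le ?_
          have := Real.pi_gt_three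
          linarith
        have hexp : Real.exp (-(x - 0) ^ 2 / (2 * s)) ≤ 1 := by
          refine Real.exp_le_one_iff.2 (div_nonpos_of_nonpos_of_nonneg ?_ (by positivity))
          have := sq_nonneg (x - 0)
          linarith
        calc _ ≤ (√(2 * Real.pi * s))⁻¹ * 1 :=
              mul_le_mul_of_nonneg_left hexp (by positivity)
          _ ≤ 1 / (2 * √s) := by
              rw [mul_one, one_div]
              exact inv_anti₀ (by positivity) hpi
    _ = ENNReal.ofReal 0.05 := by
        rw [setLIntegral_const, Real.volume_Icc, ← ENNReal.ofReal_mul (by positivity)]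
        congr 1
        field_simp
        norm_num

end LinearForms

/-! ### Weighted inner products -/

section Weighted

variable {n : ℕ}

/-- The inner product `∑ k, d k * x k * y k`. -/
def weightedInner (d x y : Fin n → ℝ) : ℝ := ∑ k, d k * x k * y k

variable {d x y z : Fin n → ℝ}

lemma weightedInner_comm : weightedInner d x y = weightedInner d y x :=
  Finset.sum_congr rfl fun k _ => by ring

lemma weightedInner_add : weightedInner d x (y + z) = weightedInner d x y + weightedInner d x z := by
  simp only [weightedInner, ← Finset.sum_add_distrib, Pi.add_apply]
  exact Finset.sum_congr rfl fun k _ => by ring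

lemma weightedInner_sub : weightedInner d x (y - z) = weightedInner d x y - weightedInner d x z := by
  simp only [weightedInner, ← Finset.sum_sub_distrib, Pi.sub_apply]
  exact Finset.sum_congr rfl fun k _ => by ring

lemma weightedInner_smul (c : ℝ) : weightedInner d x (c • y) = c * weightedInner d x y := by
  simp only [weightedInner, Finset.mul_sum, Pi.smul_apply, smul_eq_mul]
  exact Finset.sum_congr rfl fun k _ => by ring

lemma weightedInner_add_left :
    weightedInner d (x + y) z = weightedInner d x z + weightedInner d y z := by
  rw [weightedInner_comm, weightedInner_add, weightedInner_comm, weightedInner_comm (x := z)]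

lemma weightedInner_sub_left :
    weightedInner d (x - y) z = weightedInner d x z - weightedInner d y z := by
  rw [weightedInner_comm, weightedInner_sub, weightedInner_comm, weightedInner_comm (x := z)]

lemma weightedInner_smul_left (c : ℝ) :
    weightedInner d (c • x) y = c * weightedInner d x y := by
  rw [weightedInner_comm, weightedInner_smul, weightedInner_comm]

@[simp] lemma weightedInner_zero : weightedInner d x 0 = 0 := by simp [weightedInner]

lemma weightedInner_self_nonneg (hd : ∀ i, 0 < d i) : 0 ≤ weightedInner d x x :=
  Finset.sum_nonneg fun k _ => by
    have := mul_nonneg (hd k).le (mul_self_nonneg (x k))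
    linarith [mul_assoc (d k) (x k) (x k)]

lemma eq_zero_of_weightedInner_self (hd : ∀ i, 0 < d i) (h : weightedInner d x x ≤ 0) : x = 0 := by
  have hnn : ∀ k ∈ Finset.univ, 0 ≤ d k * x k * x k := fun k _ => by
    rw [mul_assoc]; exact mul_nonneg (hd k).le (mul_self_nonneg _)
  have h0 := (Finset.sum_eq_zero_iff_of_nonneg hnn).1 (le_antisymm h (Finset.sum_nonneg hnn))
  ext k
  have := h0 k (Finset.mem_univ k)
  rw [mul_assoc] at this
  simpa [(hd k).ne'] using this

lemma weightedInner_self_pos (hd : ∀ i, 0 < d i) (h : x ≠ 0) : 0 < weightedInner d x x :=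
  lt_of_not_ge fun h' => h (eq_zero_of_weightedInner_self hd h')

end Weighted

/-! ### Reversible Markov chains -/

section Reversible

variable {n : ℕ}

/-- `B` is a stochastic matrix without diagonal whose entries are at most `1 / d i` and which is
self-adjoint with respect to the weights `d`. -/
structure IsReversible (B : Matrix (Fin n) (Fin n) ℝ) (d : Fin n → ℝ) : Prop where
  pos : ∀ i, 0 < d i
  symm : ∀ i j, d i * B i j = d j * B j i
  nonneg : ∀ i j, 0 ≤ B i j
  row_sum : ∀ i, ∑ j, B i j = 1
  mul_le_one : ∀ i j, d i * B i j ≤ 1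
  diag : ∀ i, B i i = 0

/-- The lazy version `I/2 + B/2` of `B`. -/
noncomputable def lazyOf (B : Matrix (Fin n) (Fin n) ℝ) : Matrix (Fin n) (Fin n) ℝ :=
  (1 / 2 : ℝ) • (1 : Matrix (Fin n) (Fin n) ℝ) + (1 / 2 : ℝ) • B

/-- The matrix `I/2 + B/2 - J/n`. -/
noncomputable def deflatedOf (B : Matrix (Fin n) (Fin n) ℝ) : Matrix (Fin n) (Fin n) ℝ :=
  Matrix.of fun i j => lazyOf B i j - 1 / (n : ℝ)

variable {B : Matrix (Fin n) (Fin n) ℝ} {d x y : Fin n → ℝ}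

lemma lazyOf_mulVec : (lazyOf B).mulVec x = (1 / 2 : ℝ) • x + (1 / 2 : ℝ) • B.mulVec x := by
  simp [lazyOf, Matrix.add_mulVec, Matrix.smul_mulVec]

lemma deflatedOf_mulVec : (deflatedOf B).mulVec x =
    (lazyOf B).mulVec x - ((1 / (n : ℝ)) * ∑ j, x j) • (1 : Fin n → ℝ) := by
  ext i
  simp only [deflatedOf, Matrix.mulVec, dotProduct, Matrix.of_apply, sub_mul,
    Finset.sum_sub_distrib, Pi.sub_apply, Pi.smul_apply, Pi.one_apply, smul_eq_mul, mul_one,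
    Finset.mul_sum]

namespace IsReversible

lemma mulVec_one (hB : IsReversible B d) : B.mulVec 1 = 1 := by
  ext i
  simpa [Matrix.mulVec, dotProduct] using hB.row_sum i

lemma lazyOf_mulVec_one (hB : IsReversible B d) : (lazyOf B).mulVec 1 = 1 := by
  rw [lazyOf_mulVec, hB.mulVec_one]
  ext i
  norm_num

lemma deflatedOf_mulVec_one (hB : IsReversible B d) : (deflatedOf B).mulVec 1 = 0 := by
  rw [deflatedOf_mulVec, hB.lazyOf_mulVec_one]
  ext i
  have : (n : ℝ) ≠ 0 := by
    have := i.pos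
    positivity
  simp [this]

lemma weightedInner_mulVec (hB : IsReversible B d) :
    weightedInner d x (B.mulVec y) = weightedInner d (B.mulVec x) y := by
  simp only [weightedInner, Matrix.mulVec, dotProduct, Finset.mul_sum, Finset.sum_mul]
  rw [Finset.sum_comm]
  refine Finset.sum_congr rfl fun i _ => Finset.sum_congr rfl fun j _ => ?_
  linear_combination x j * y i * hB.symm j i

lemma weightedInner_lazyOf_mulVec (hB : IsReversible B d) :
    weightedInner d x ((lazyOf B).mulVec y) = weightedInner d ((lazyOf B).mulVec x) y := by
  rw [lazyOf_mulVec, lazyOf_mulVec, weightedInner_add, weightedInner_add_left, weightedInner_smul,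
    weightedInner_smul, weightedInner_smul_left, weightedInner_smul_left, hB.weightedInner_mulVec]

lemma weightedInner_one_lazyOf (hB : IsReversible B d) :
    weightedInner d 1 ((lazyOf B).mulVec y) = weightedInner d 1 y := by
  rw [hB.weightedInner_lazyOf_mulVec, hB.lazyOf_mulVec_one]

lemma abs_mulVec_le (hB : IsReversible B d) {M : ℝ} (hM : ∀ j, |x j| ≤ M) (i : Fin n) :
    |B.mulVec x i| ≤ M := by
  calc |∑ j, B i j * x j| ≤ ∑ j, |B i j * x j| := Finset.abs_sum_le_sum_abs _ _
    _ ≤ ∑ j, B i j * M := by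
        refine Finset.sum_le_sum fun j _ => ?_
        rw [abs_mul, abs_of_nonneg (hB.nonneg i j)]
        exact mul_le_mul_of_nonneg_left (hM j) (hB.nonneg i j)
    _ = M := by rw [← Finset.sum_mul, hB.row_sum, one_mul]

lemma abs_lazyOf_mulVec_le (hB : IsReversible B d) {M : ℝ} (hM : ∀ j, |x j| ≤ M) (i : Fin n) :
    |(lazyOf B).mulVec x i| ≤ M := by
  have h1 := abs_le.1 (hB.abs_mulVec_le hM i)
  have h2 := abs_le.1 (hM i)
  rw [lazyOf_mulVec]
  simp only [Pi.add_apply, Pi.smul_apply, smul_eq_mul]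
  rw [abs_le]
  constructor <;> linarith [h1.1, h1.2, h2.1, h2.2]

lemma abs_deflatedOf_mulVec_le (hB : IsReversible B d) {M : ℝ} (hM : ∀ j, |x j| ≤ M) (i : Fin n) :
    |(deflatedOf B).mulVec x i| ≤ 2 * M := by
  have hn : (0 : ℝ) < n := by exact_mod_cast i.pos
  have h1 := hB.abs_lazyOf_mulVec_le hM i
  have h2 : |(1 / (n : ℝ)) * ∑ j, x j| ≤ M := by
    rw [abs_mul, abs_of_pos (by positivity)]
    calc 1 / (n : ℝ) * |∑ j, x j| ≤ 1 / (n : ℝ) * ∑ _j : Fin n, M :=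
          mul_le_mul_of_nonneg_left ((Finset.abs_sum_le_sum_abs _ _).trans
            (Finset.sum_le_sum fun j _ => hM j)) (by positivity)
      _ = M := by
          simp only [Finset.sum_const, Finset.card_univ, Fintype.card_fin, nsmul_eq_mul]
          field_simp
  rw [deflatedOf_mulVec]
  simp only [Pi.sub_apply, Pi.smul_apply, Pi.one_apply, smul_eq_mul, mul_one]
  exact (abs_sub _ _).trans (by linarith)

lemma abs_eigenvalue_le_one (hB : IsReversible B d) {σ : ℝ} (hx : x ≠ 0)
    (h : B.mulVec x = σ • x) : |σ| ≤ 1 := by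
  obtain ⟨k, hk⟩ := Function.ne_iff.1 hx
  have : Nonempty (Fin n) := ⟨k⟩
  obtain ⟨i, hi⟩ := Finite.exists_max fun j => |x j|
  have h1 := hB.abs_mulVec_le hi i
  rw [h, Pi.smul_apply, smul_eq_mul, abs_mul] at h1
  have hpos : 0 < |x i| := (abs_pos.2 hk).trans_le (hi k)
  nlinarith

/-- A matrix with small entries maps the weighted `ℓ²` space to the bounded functions. -/
lemma sq_mulVec_le (hB : IsReversible B d) {m : ℝ} (hm : 0 < m) (hd : ∀ i, m ≤ d i) (i : Fin n) :
    (B.mulVec x i) ^ 2 ≤ weightedInner d x x / m ^ 2 := by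
  -- Cauchy–Schwarz against the probability vector `B i ·`. One factor `1/m` comes from `B i j ≤ 1 /
  -- d i`, the other from inserting the weight `d j ≥ m`.
  have h := Finset.sum_sq_le_sum_mul_sum_of_sq_le_mul Finset.univ (r := fun j => B i j * x j)
    (f := fun j => B i j) (g := fun j => B i j * x j ^ 2) (fun j _ => hB.nonneg i j)
    (fun j _ => mul_nonneg (hB.nonneg i j) (sq_nonneg _)) (fun j _ => le_of_eq (by ring))
  rw [hB.row_sum, one_mul] at h
  refine h.trans ?_
  rw [weightedInner, Finset.sum_div]
  refine Finset.sum_le_sum fun j _ => ?_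
  have hBm : B i j ≤ 1 / m := by
    rw [le_div_iff₀ hm]
    calc B i j * m ≤ B i j * d i := mul_le_mul_of_nonneg_left (hd i) (hB.nonneg i j)
      _ ≤ 1 := by rw [mul_comm]; exact hB.mul_le_one i j
  calc B i j * x j ^ 2 ≤ 1 / m * x j ^ 2 := mul_le_mul_of_nonneg_right hBm (sq_nonneg _)
    _ = m * x j ^ 2 / m ^ 2 := by field_simp
    _ ≤ d j * x j ^ 2 / m ^ 2 := by gcongr; exact hd j
    _ = _ := by ring

lemma le_card (hB : IsReversible B d) (i : Fin n) : d i ≤ n := by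
  calc d i = ∑ j, d i * B i j := by rw [← Finset.mul_sum, hB.row_sum, mul_one]
    _ ≤ ∑ _j : Fin n, (1 : ℝ) := Finset.sum_le_sum fun j _ => hB.mul_le_one i j
    _ = n := by simp

/-- The spectral theorem for a reversible chain. -/
lemma exists_orthonormal_eigenvectors (hB : IsReversible B d) :
    ∃ (q : Fin n → Fin n → ℝ) (σ : Fin n → ℝ), (∀ j, B.mulVec (q j) = σ j • q j) ∧
      ∀ x, weightedInner d x x = ∑ j, weightedInner d (q j) x ^ 2 := by
  have hs : ∀ i, 0 < √(d i) := fun i => Real.sqrt_pos.2 (hB.pos i)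
  have hss : ∀ i, √(d i) * √(d i) = d i := fun i => Real.mul_self_sqrt (hB.pos i).le
  -- Conjugating by `√d` makes the chain symmetric; the eigenvectors of `S` divided by `√d` are
  -- those of `B`, orthonormal for the weights.
  let S : Matrix (Fin n) (Fin n) ℝ := Matrix.of fun i j => √(d i) * B i j / √(d j)
  have hS : S.IsHermitian := by
    ext i j
    simp only [S, Matrix.conjTranspose_apply, Matrix.of_apply, star_trivial]
    rw [div_eq_div_iff (hs i).ne' (hs j).ne']
    linear_combination (B j i) * hss j - (B i j) * hss i - hB.symm i j
  refine ⟨fun j i => hS.eigenvectorBasis j i / √(d i), hS.eigenvalues, fun j => ?_, fun x => ?_⟩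
  · have h := hS.mulVec_eigenvectorBasis j
    ext i
    have hi := congrFun h i
    simp only [Matrix.mulVec, dotProduct, S, Matrix.of_apply, Pi.smul_apply, smul_eq_mul] at hi ⊢
    rw [mul_div_assoc', eq_div_iff (hs i).ne', ← hi, Finset.sum_mul]
    refine Finset.sum_congr rfl fun k _ => ?_
    have := hs k
    field_simp
  · have h := hS.eigenvectorBasis.sum_sq_inner_right (WithLp.toLp 2 fun i => √(d i) * x i)
    rw [EuclideanSpace.real_norm_sq_eq] at h
    have h1 : weightedInner d x x = ∑ i, (√(d i) * x i) ^ 2 := by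
      refine Finset.sum_congr rfl fun i _ => ?_
      linear_combination -(x i) ^ 2 * hss i
    rw [h1]
    refine h.symm.trans ?_
    refine Finset.sum_congr rfl fun j _ => ?_
    congr 1
    simp only [PiLp.inner_apply, weightedInner, RCLike.inner_apply, conj_trivial]
    refine Finset.sum_congr rfl fun i _ => ?_
    have := hs i
    field_simp
    linear_combination (x i * hS.eigenvectorBasis j i) * hss i

/-- The lazy chain contracts a vector that is orthogonal to all eigenvectors with large
eigenvalues. -/
lemma weightedInner_lazyOf_self_le (hB : IsReversible B d) {β : ℝ}
    (h : ∀ (σ : ℝ) (f : Fin n → ℝ), f ≠ 0 → B.mulVec f = σ • f →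
      (1 + σ) / 2 ≤ β ∨ weightedInner d f x = 0) :
    weightedInner d ((lazyOf B).mulVec x) ((lazyOf B).mulVec x) ≤ β ^ 2 * weightedInner d x x := by
  obtain ⟨q, σ, hq, hP⟩ := hB.exists_orthonormal_eigenvectors
  rw [hP, hP x, Finset.mul_sum]
  refine Finset.sum_le_sum fun j _ => ?_
  have hW : (lazyOf B).mulVec (q j) = ((1 + σ j) / 2) • q j := by
    rw [lazyOf_mulVec, hq j]
    ext i
    simp only [Pi.add_apply, Pi.smul_apply, smul_eq_mul]
    ring
  rw [hB.weightedInner_lazyOf_mulVec, hW, weightedInner_smul_left, mul_pow]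
  by_cases h0 : q j = 0
  · simp [h0, weightedInner]
  -- Laziness matters here: `-1 ≤ σ j` makes `(1 + σ j) / 2` nonnegative, so a one-sided bound may
  -- be squared.
  rcases h (σ j) (q j) h0 (hq j) with h1 | h1
  · have h2 := (abs_le.1 (hB.abs_eigenvalue_le_one h0 (hq j))).1
    exact mul_le_mul_of_nonneg_right (pow_le_pow_left₀ (by linarith) h1 2) (sq_nonneg _)
  · simp [h1]

end IsReversible

end Reversible

/-! ### Eigenbases -/

namespace IsEigenbasis

variable {n : ℕ} {A : Matrix (Fin n) (Fin n) ℝ} {μ : Fin n → ℝ}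
  {v : Module.Basis (Fin n) ℝ (Fin n → ℝ)} {x : Fin n → ℝ}

lemma repr_mulVec (h : IsEigenbasis A μ v) (j : Fin n) :
    v.repr (A.mulVec x) j = μ j * v.repr x j := by
  have hx : A.mulVec x = ∑ k, (v.repr x k * μ k) • v k := by
    conv_lhs => rw [← v.sum_repr x]
    have := map_sum A.mulVecLin (fun k => v.repr x k • v k) Finset.univ
    simp only [Matrix.mulVecLin_apply] at this
    rw [this]
    refine Finset.sum_congr rfl fun k _ => ?_
    rw [Matrix.mulVec_smul, h.eigen, smul_smul]
  rw [hx, v.repr_sum_self, mul_comm]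

lemma eigenvalue_eq (h : IsEigenbasis A μ v) {σ : ℝ} (hx : A.mulVec x = σ • x) {j : Fin n}
    (hj : v.repr x j ≠ 0) : μ j = σ := by
  have h1 := h.repr_mulVec (x := x) j
  rw [hx, map_smul, Finsupp.smul_apply, smul_eq_mul] at h1
  exact (mul_right_cancel₀ hj h1).symm

lemma exists_eigenvalue_eq (h : IsEigenbasis A μ v) {σ : ℝ} (hx : A.mulVec x = σ • x)
    (h0 : x ≠ 0) : ∃ j, μ j = σ := by
  by_contra! hne
  refine h0 (v.repr.injective ?_)
  ext j
  by_contra hj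
  exact hne j (h.eigenvalue_eq hx (by simpa using hj))

lemma le_of_eigenvector [NeZero n] (h : IsEigenbasis A μ v) {σ : ℝ} (hx : A.mulVec x = σ • x)
    (h0 : x ≠ 0) : σ ≤ μ 0 := by
  obtain ⟨j, hj⟩ := h.exists_eigenvalue_eq hx h0
  rw [← hj]
  exact h.antitone (Fin.zero_le j)

lemma sum_eigenvalues (h : IsEigenbasis A μ v) : ∑ j, μ j = ∑ i, A i i := by
  have h1 := LinearMap.trace_eq_matrix_trace ℝ v A.mulVecLin
  have h2 := Matrix.trace_toLin'_eq (R := ℝ) A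
  rw [Matrix.toLin'_apply', h1] at h2
  simp only [Matrix.trace, Matrix.diag_apply, LinearMap.toMatrix_apply, Matrix.mulVecLin_apply,
    h.repr_mulVec, v.repr_self, Finsupp.single_eq_same, mul_one] at h2
  exact h2

/-- An eigenvector whose eigenvalue differs from all but the first two is a combination of the
first two basis vectors. -/
lemma eq_add_of_forall_ne [NeZero n] (h : IsEigenbasis A μ v) (hn : 2 ≤ n) {σ : ℝ}
    (hx : A.mulVec x = σ • x) (hσ : ∀ j : Fin n, 2 ≤ (j : ℕ) → μ j ≠ σ) :
    x = v.repr x 0 • v 0 + v.repr x 1 • v 1 := by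
  have h01 : (0 : Fin n) ≠ 1 := by
    intro h
    have := congrArg Fin.val h
    simp [Nat.mod_eq_of_lt hn] at this
  conv_lhs => rw [← v.sum_repr x]
  refine Fintype.sum_eq_add 0 1 h01 fun j hj => ?_
  have hj2 : 2 ≤ (j : ℕ) := by
    have h0 : (j : ℕ) ≠ 0 := fun h => hj.1 (Fin.ext (by simpa using h))
    have h1 : (j : ℕ) ≠ 1 := fun h => hj.2 (Fin.ext (by
      rw [Fin.val_one', Nat.mod_eq_of_lt hn]; exact h))
    omega
  have : v.repr x j = 0 := by
    by_contra hne
    exact hσ j hj2 (h.eigenvalue_eq hx hne)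
  rw [this, zero_smul]

end IsEigenbasis

/-! ### The spectrum of the deflated matrix -/

/-- A reversible chain with spectral gap `s ^ 2` after the second eigenvalue, together with
eigenbases of `B` and of `I/2 + B/2 - J/n`. -/
structure IsGapped {n : ℕ} [NeZero n] (B : Matrix (Fin n) (Fin n) ℝ) (d : Fin n → ℝ)
    (κ : Fin n → ℝ) (u : Module.Basis (Fin n) ℝ (Fin n → ℝ))
    (μ : Fin n → ℝ) (v : Module.Basis (Fin n) ℝ (Fin n → ℝ)) (s : ℝ) : Prop where
  rev : IsReversible B d
  eigenB : IsEigenbasis B κ u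
  eigenD : IsEigenbasis (deflatedOf B) μ v
  one_lt : 1 < s
  gap : ∀ j : Fin n, 2 ≤ (j : ℕ) → κ j + 1 ≤ (κ 1 + 1) / s ^ 2
  -- This says that `n` is large in terms of `s`; it is the numerical input of the trace argument in
  -- `le_kappa_one`.
  card : s * (s ^ 2 + (n - 2)) ≤ s ^ 2 * (n - 2)
  two_le : 2 ≤ n
  le_sq : ∀ i, (n : ℝ) ≤ d i ^ 2

namespace IsGapped

variable {n : ℕ} [NeZero n] {B : Matrix (Fin n) (Fin n) ℝ} {d : Fin n → ℝ}
  {κ : Fin n → ℝ} {u : Module.Basis (Fin n) ℝ (Fin n → ℝ)}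
  {μ : Fin n → ℝ} {v : Module.Basis (Fin n) ℝ (Fin n → ℝ)} {s : ℝ} {x y : Fin n → ℝ}

lemma one_ne_zero' (_h : IsGapped B d κ u μ v s) : (1 : Fin n → ℝ) ≠ 0 := by
  intro h0
  simpa using congrFun h0 0

lemma kappa_zero (h : IsGapped B d κ u μ v s) : κ 0 = 1 := by
  refine le_antisymm ?_ ?_
  · exact (abs_le.1 (h.rev.abs_eigenvalue_le_one (u.ne_zero 0) (h.eigenB.eigen 0))).2
  · refine h.eigenB.le_of_eigenvector (x := 1) ?_ h.one_ne_zero'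
    rw [h.rev.mulVec_one, one_smul]

lemma kappa_one_le (h : IsGapped B d κ u μ v s) : κ 1 ≤ 1 := by
  rw [← h.kappa_zero]
  exact h.eigenB.antitone (Fin.zero_le 1)

/-- `B` has trace zero, so the numbers `κ j + 1` sum to `n`. The first is `2` and all from the third
on are at most `(κ 1 + 1) / s ^ 2`; a small `κ 1` would make the sum too small. As `n` grows the
argument gives almost `s ^ 2`, and the lost factor `s` is the slack for finite `n`. -/
lemma le_kappa_one (h : IsGapped B d κ u μ v s) : s ≤ κ 1 + 1 := by
  have hs := h.one_lt
  have hn := h.two_le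
  have htr : ∑ j, κ j = 0 := by
    rw [h.eigenB.sum_eigenvalues]
    exact Finset.sum_eq_zero fun i _ => h.rev.diag i
  have h01 : (0 : Fin n) ≠ 1 := by
    intro h
    have := congrArg Fin.val h
    simp [Nat.mod_eq_of_lt hn] at this
  set q := (κ 1 + 1) / s ^ 2 with hq
  have hle : ∑ j, (κ j + 1) ≤
      ∑ j : Fin n, (q + (if j = 0 then 2 - q else 0) + if j = 1 then κ 1 + 1 - q else 0) := by
    refine Finset.sum_le_sum fun j _ => ?_
    by_cases h0 : j = 0
    · subst h0
      have := h.kappa_zero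
      simp only [if_true, if_neg h01]
      linarith
    by_cases h1 : j = 1
    · subst h1
      simp only [if_true, if_neg h01.symm]
      linarith
    have hj2 : 2 ≤ (j : ℕ) := by
      have h0' : (j : ℕ) ≠ 0 := fun h => h0 (Fin.ext (by simpa using h))
      have h1' : (j : ℕ) ≠ 1 := fun h => h1 (Fin.ext (by
        rw [Fin.val_one', Nat.mod_eq_of_lt hn]; exact h))
      omega
    simp only [if_neg h0, if_neg h1]
    linarith [h.gap j hj2]
  rw [Finset.sum_add_distrib, htr, Finset.sum_add_distrib, Finset.sum_add_distrib] at hle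
  simp only [Finset.sum_const, Finset.card_univ, Fintype.card_fin, nsmul_eq_mul, mul_one,
    Finset.sum_ite_eq', Finset.mem_univ, if_true, zero_add] at hle
  have hqs : q * s ^ 2 = κ 1 + 1 := by
    rw [hq]; field_simp
  have hcard := h.card
  have hn2 : (2 : ℝ) ≤ n := by exact_mod_cast hn
  have h3 : (n - 2 : ℝ) ≤ q * (s ^ 2 + (n - 2)) := by linarith
  have hpos : 0 < s ^ 2 + ((n : ℝ) - 2) := by nlinarith
  have h4 : s * (s ^ 2 + ((n : ℝ) - 2)) ≤ (κ 1 + 1) * (s ^ 2 + (n - 2)) := by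
    calc _ ≤ s ^ 2 * ((n : ℝ) - 2) := hcard
      _ ≤ s ^ 2 * (q * (s ^ 2 + (n - 2))) := mul_le_mul_of_nonneg_left h3 (sq_nonneg s)
      _ = _ := by rw [← hqs]; ring
  exact le_of_mul_le_mul_right h4 hpos

/-- The eigenvalues of the lazy chain are also eigenvalues of the deflated matrix. -/
lemma lambda_le_mu_zero (h : IsGapped B d κ u μ v s) : (κ 1 + 1) / 2 ≤ μ 0 := by
  have hs := h.one_lt
  have hk := h.le_kappa_one
  have h01 : (0 : Fin n) ≠ 1 := by
    intro h'
    have := congrArg Fin.val h'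
    simp [Nat.mod_eq_of_lt h.two_le] at this
  set l := (κ 1 + 1) / 2 with hl
  -- A nonconstant eigenvector of `B` for `κ 1` becomes an eigenvector of the deflated matrix after
  -- subtracting a constant vector, since that matrix kills constants.
  have key : ∀ f : Fin n → ℝ, B.mulVec f = κ 1 • f → (∀ c : ℝ, f ≠ c • 1) → l ≤ μ 0 := by
    intro f hf hne
    set a := (1 / (n : ℝ)) * ∑ j, f j with ha
    have hl0 : l ≠ 0 := by rw [hl]; intro h0; linarith
    refine h.eigenD.le_of_eigenvector (x := f - (a / l) • 1) ?_ fun h0 => hne (a / l) ?_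
    · rw [Matrix.mulVec_sub, Matrix.mulVec_smul, h.rev.deflatedOf_mulVec_one, deflatedOf_mulVec,
        lazyOf_mulVec, hf, ← ha]
      ext i
      simp only [Pi.add_apply, Pi.sub_apply, Pi.smul_apply, smul_eq_mul, Pi.one_apply,
        Pi.zero_apply]
      field_simp
      rw [hl]
      ring
    · exact sub_eq_zero.1 h0
  -- If `u 1` is constant, then `κ 1 = 1 = κ 0`, and `u 0` serves as the nonconstant eigenvector.
  by_cases hu : ∃ c : ℝ, u 1 = c • 1
  · obtain ⟨c, hc⟩ := hu
    have hc0 : c ≠ 0 := by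
      rintro rfl
      exact u.ne_zero 1 (by rw [hc, zero_smul])
    have h1 : B.mulVec (u 1) = (1 : ℝ) • u 1 := by
      rw [hc, Matrix.mulVec_smul, h.rev.mulVec_one, one_smul]
    have hk1 : κ 1 = 1 := h.eigenB.eigenvalue_eq (j := 1) h1 (by simp)
    refine key (u 0) (by rw [h.eigenB.eigen, h.kappa_zero, hk1]) fun c' hc' => ?_
    have : c • u 0 = c' • u 1 := by rw [hc, hc', smul_comm]
    have h2 := congrArg (fun z => u.repr z 0) this
    simp [h01] at h2
    exact hc0 h2
  · exact key (u 1) (h.eigenB.eigen 1) (by simpa using hu)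

lemma mu_zero_pos (h : IsGapped B d κ u μ v s) : 0 < μ 0 := by
  have := h.lambda_le_mu_zero
  have := h.le_kappa_one
  have := h.one_lt
  linarith

lemma repr_one (h : IsGapped B d κ u μ v s) : v.repr 1 0 = 0 := by
  have h1 := h.eigenD.repr_mulVec (x := 1) 0
  rw [h.rev.deflatedOf_mulVec_one] at h1
  simpa [h.mu_zero_pos.ne'] using h1.symm

/-- The vector that represents the first coordinate in the basis `v` with respect to the weighted
inner product. -/
noncomputable def dualVec {n : ℕ} [NeZero n] (d : Fin n → ℝ)
    (v : Module.Basis (Fin n) ℝ (Fin n → ℝ)) (k : Fin n) : ℝ :=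
  v.repr (Pi.single k 1) 0 / d k

lemma repr_eq_sum (x : Fin n → ℝ) : v.repr x 0 = ∑ k, v.repr (Pi.single k 1) 0 * x k := by
  conv_lhs => rw [← Finset.univ_sum_single x]
  rw [map_sum, Finsupp.finsetSum_apply]
  refine Finset.sum_congr rfl fun k _ => ?_
  have : (Pi.single k (x k) : Fin n → ℝ) = x k • Pi.single k 1 := by
    rw [← Pi.single_smul]; simp
  rw [this, map_smul, Finsupp.smul_apply, smul_eq_mul, mul_comm]

lemma weightedInner_dualVec (h : IsGapped B d κ u μ v s) (x : Fin n → ℝ) :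
    weightedInner d (dualVec d v) x = v.repr x 0 := by
  rw [repr_eq_sum]
  refine Finset.sum_congr rfl fun k _ => ?_
  rw [dualVec, mul_div_cancel₀ _ (h.rev.pos k).ne']

lemma dualVec_ne_zero (h : IsGapped B d κ u μ v s) : dualVec d v ≠ 0 := by
  intro h0
  have h1 := h.weightedInner_dualVec (v 0)
  rw [h0] at h1
  simp [weightedInner] at h1

lemma weightedInner_one_dualVec (h : IsGapped B d κ u μ v s) :
    weightedInner d 1 (dualVec d v) = 0 := by
  rw [weightedInner_comm, h.weightedInner_dualVec, h.repr_one]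

/-- The first coordinate functional is a left eigenvector of the deflated matrix. It vanishes on
constants, so the `J/n` term drops out, and self-adjointness of the lazy walk turns the left
eigenvector into a right one. -/
lemma lazyOf_dualVec (h : IsGapped B d κ u μ v s) :
    (lazyOf B).mulVec (dualVec d v) = μ 0 • dualVec d v := by
  have key : ∀ x, weightedInner d ((lazyOf B).mulVec (dualVec d v) - μ 0 • dualVec d v) x = 0 := by
    intro x
    have h1 := h.eigenD.repr_mulVec (x := x) 0
    rw [deflatedOf_mulVec, map_sub, map_smul, Finsupp.sub_apply, Finsupp.smul_apply,
      h.repr_one, smul_zero, sub_zero, ← h.weightedInner_dualVec, ← h.weightedInner_dualVec,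
      h.rev.weightedInner_lazyOf_mulVec] at h1
    rw [weightedInner_sub_left, weightedInner_smul_left, h1, sub_self]
  exact sub_eq_zero.1 (eq_zero_of_weightedInner_self h.rev.pos (key _).le)

lemma mulVec_dualVec (h : IsGapped B d κ u μ v s) :
    B.mulVec (dualVec d v) = (2 * μ 0 - 1) • dualVec d v := by
  have h1 := h.lazyOf_dualVec
  rw [lazyOf_mulVec] at h1
  ext i
  have := congrFun h1 i
  simp only [Pi.add_apply, Pi.smul_apply, smul_eq_mul] at this ⊢
  linarith

/-- If `μ 0` were larger, `dualVec` would be an eigenvector of `B` with eigenvalue above `κ 1`,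
hence a multiple of `u 0`. So would the constant vector, yet these two nonzero vectors are
orthogonal. -/
lemma mu_zero (h : IsGapped B d κ u μ v s) : μ 0 = (κ 1 + 1) / 2 := by
  refine le_antisymm ?_ h.lambda_le_mu_zero
  by_contra! hlt
  have hlt1 : κ 1 < 2 * μ 0 - 1 := by linarith
  have hlt2 : ∀ j : Fin n, j ≠ 0 → κ j ≤ κ 1 := by
    intro j hj
    refine h.eigenB.antitone (Fin.le_def.2 ?_)
    rw [Fin.val_one', Nat.mod_eq_of_lt h.two_le]
    exact Nat.one_le_iff_ne_zero.2 fun h0 => hj (Fin.ext (by simpa using h0))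
  have h0 := h.kappa_zero
  have hrep : ∀ {σ : ℝ} {f : Fin n → ℝ}, κ 1 < σ → B.mulVec f = σ • f →
      f = u.repr f 0 • u 0 := by
    intro σ f hσ hf
    conv_lhs => rw [← u.sum_repr f]
    refine Fintype.sum_eq_single 0 fun j hj => ?_
    have : u.repr f j = 0 := by
      by_contra hne
      have := h.eigenB.eigenvalue_eq hf hne
      linarith [hlt2 j hj]
    rw [this, zero_smul]
  have hp := hrep hlt1 h.mulVec_dualVec
  have hp0 : u.repr (dualVec d v) 0 ≠ 0 := by
    intro h0
    rw [h0, zero_smul] at hp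
    exact h.dualVec_ne_zero hp
  have hk0 : κ 0 = 2 * μ 0 - 1 := h.eigenB.eigenvalue_eq h.mulVec_dualVec hp0
  have h1 := hrep (σ := 1) (f := 1) (by linarith) (by rw [h.rev.mulVec_one, one_smul])
  have h10 : u.repr 1 0 ≠ 0 := by
    intro h0
    rw [h0, zero_smul] at h1
    exact h.one_ne_zero' h1
  have horth := h.weightedInner_one_dualVec
  rw [h1, hp, weightedInner_smul, weightedInner_smul_left] at horth
  have := weightedInner_self_pos h.rev.pos (u.ne_zero 0)
  exact (mul_ne_zero hp0 (mul_ne_zero h10 this.ne')) horth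

lemma le_two_mu_zero (h : IsGapped B d κ u μ v s) : s ≤ 2 * μ 0 := by
  rw [h.mu_zero]
  linarith [h.le_kappa_one]

/-- An eigenvalue of `B` either occurs among the `κ j` with `j ≥ 2`, where the gap applies, or its
eigenvectors lie in the span of `u 0` and `u 1`. That plane is also spanned by `1` and `dualVec`, to
which `x` is orthogonal. -/
lemma weightedInner_eigenvector (h : IsGapped B d κ u μ v s)
    (h1x : weightedInner d 1 x = 0) (hpx : weightedInner d (dualVec d v) x = 0)
    (σ : ℝ) (f : Fin n → ℝ) (hf : B.mulVec f = σ • f) :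
    (1 + σ) / 2 ≤ μ 0 / s ^ 2 ∨ weightedInner d f x = 0 := by
  have hs := h.one_lt
  have hs2 : 1 < s ^ 2 := by nlinarith
  have hk := h.le_kappa_one
  by_cases hσ : ∃ j : Fin n, 2 ≤ (j : ℕ) ∧ κ j = σ
  · obtain ⟨j, hj, rfl⟩ := hσ
    left
    have := h.gap j hj
    rw [h.mu_zero, div_right_comm]
    linarith
  right
  push Not at hσ
  have hlt : ∀ j : Fin n, 2 ≤ (j : ℕ) → κ j < κ 1 := by
    intro j hj
    have h1 := h.gap j hj
    have : (κ 1 + 1) / s ^ 2 < κ 1 + 1 := div_lt_self (by linarith) hs2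
    linarith
  set p := dualVec d v with hpdef
  have hBp : B.mulVec p = κ 1 • p := by
    rw [h.mulVec_dualVec, h.mu_zero]
    congr 1
    ring
  have ef := h.eigenB.eq_add_of_forall_ne h.two_le hf hσ
  have ep := h.eigenB.eq_add_of_forall_ne h.two_le hBp fun j hj => (hlt j hj).ne
  have e1 := h.eigenB.eq_add_of_forall_ne h.two_le (x := 1) (σ := 1)
    (by rw [h.rev.mulVec_one, one_smul])
    fun j hj => ((hlt j hj).trans_le h.kappa_one_le).ne
  generalize u.repr f 0 = f0 at ef
  generalize u.repr f 1 = f1 at ef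
  generalize u.repr p 0 = b0 at ep
  generalize u.repr p 1 = b1 at ep
  generalize u.repr 1 0 = a0 at e1
  generalize u.repr 1 1 = a1 at e1
  -- Cramer's rule expresses `f` through `1` and `p`; the determinant is nonzero because these are
  -- nonzero and orthogonal.
  have hΔf : (a0 * b1 - a1 * b0) • f
      = (f0 * b1 - f1 * b0) • (1 : Fin n → ℝ) + (a0 * f1 - a1 * f0) • p := by
    rw [ef, ep, e1]
    ext i
    simp only [Pi.add_apply, Pi.smul_apply, smul_eq_mul]
    ring
  have hΔ : a0 * b1 - a1 * b0 ≠ 0 := by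
    intro h0
    have hp1 := h.weightedInner_one_dualVec
    have hpos1 := weightedInner_self_pos h.rev.pos h.one_ne_zero'
    have key : ∀ α β : ℝ, α • (1 : Fin n → ℝ) = β • p → α = 0 ∧ β = 0 := by
      intro α β hαβ
      have hα : α = 0 := by
        have := congrArg (weightedInner d 1) hαβ
        rw [weightedInner_smul, weightedInner_smul, hp1, mul_zero] at this
        exact (mul_eq_zero.1 this).resolve_right hpos1.ne'
      refine ⟨hα, ?_⟩
      rw [hα, zero_smul] at hαβ
      exact (smul_eq_zero.1 hαβ.symm).resolve_right h.dualVec_ne_zero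
    have k1 := key b0 a0 (by
      rw [ep, e1]; ext i
      simp only [Pi.add_apply, Pi.smul_apply, smul_eq_mul]
      linear_combination -(u 1 i) * h0)
    have k2 := key b1 a1 (by
      rw [ep, e1]; ext i
      simp only [Pi.add_apply, Pi.smul_apply, smul_eq_mul]
      linear_combination (u 0 i) * h0)
    apply h.dualVec_ne_zero
    rw [← hpdef, ep, k1.1, k2.1, zero_smul, zero_smul, add_zero]
  have := congrArg (fun z => weightedInner d z x) hΔf
  simp only [weightedInner_add_left, weightedInner_smul_left, h1x, hpx, mul_zero, add_zero] at this
  exact (mul_eq_zero.1 this).resolve_left hΔ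

lemma contraction (h : IsGapped B d κ u μ v s)
    (h1x : weightedInner d 1 x = 0) (hpx : weightedInner d (dualVec d v) x = 0) :
    weightedInner d ((lazyOf B).mulVec x) ((lazyOf B).mulVec x)
      ≤ (μ 0 / s ^ 2) ^ 2 * weightedInner d x x :=
  h.rev.weightedInner_lazyOf_self_le fun σ f _ hf => h.weightedInner_eigenvector h1x hpx σ f hf

/-- The eigenvalue `μ 0` is simple. After subtracting its weighted mean, such an `x` is an
eigenvector of the lazy walk orthogonal to `1` and `dualVec`, where the walk contracts strictly more
than `μ 0`. So `x` is constant and is killed by the deflated matrix. -/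
lemma eq_zero_of_eigenvector (h : IsGapped B d κ u μ v s)
    (hx : (deflatedOf B).mulVec x = μ 0 • x) (h0 : v.repr x 0 = 0) : x = 0 := by
  have hμ := h.mu_zero_pos
  have hs := h.one_lt
  have hpos1 := weightedInner_self_pos h.rev.pos h.one_ne_zero'
  set c := weightedInner d 1 x / weightedInner d 1 1 with hc
  set a := (1 / (n : ℝ)) * ∑ j, x j with ha
  set y := x - c • (1 : Fin n → ℝ) with hy
  have h1y : weightedInner d 1 y = 0 := by
    rw [hy, weightedInner_sub, weightedInner_smul, hc]
    field_simp
    ring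
  have hpy : weightedInner d (dualVec d v) y = 0 := by
    rw [hy, weightedInner_sub, weightedInner_smul, weightedInner_comm (y := 1),
      h.weightedInner_one_dualVec, h.weightedInner_dualVec, h0, mul_zero, sub_zero]
  have hW : (lazyOf B).mulVec y = μ 0 • y + (μ 0 * c + a - c) • (1 : Fin n → ℝ) := by
    have hx' := hx
    rw [deflatedOf_mulVec, ← ha] at hx'
    rw [hy, Matrix.mulVec_sub, Matrix.mulVec_smul, h.rev.lazyOf_mulVec_one,
      sub_eq_iff_eq_add.1 hx']
    ext i
    simp only [Pi.add_apply, Pi.sub_apply, Pi.smul_apply, smul_eq_mul, Pi.one_apply]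
    ring
  have hz : μ 0 * c + a - c = 0 := by
    have h1 := h.rev.weightedInner_one_lazyOf (y := y)
    rw [hW, weightedInner_add, weightedInner_smul, weightedInner_smul, h1y, mul_zero, zero_add] at h1
    exact (mul_eq_zero.1 h1).resolve_right hpos1.ne'
  rw [hz, zero_smul, add_zero] at hW
  have hcon := h.contraction h1y hpy
  rw [hW, weightedInner_smul, weightedInner_smul_left] at hcon
  have hy0 : y = 0 := by
    by_contra hne
    have hpos := weightedInner_self_pos h.rev.pos hne
    have h2 : μ 0 / s ^ 2 < μ 0 := div_lt_self hμ (by nlinarith)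
    have h3 : (μ 0 / s ^ 2) ^ 2 < μ 0 ^ 2 := pow_lt_pow_left₀ h2 (by positivity) two_ne_zero
    nlinarith
  have hxc : x = c • (1 : Fin n → ℝ) := sub_eq_zero.1 hy0
  rw [hxc, Matrix.mulVec_smul, h.rev.deflatedOf_mulVec_one, smul_zero] at hx
  rw [hxc]
  exact (smul_eq_zero.1 hx.symm).resolve_left hμ.ne'

/-- The right side is an eigenvector for `μ 0` with first coordinate `1`; simplicity identifies it
with `v 0`. -/
lemma basis_zero_eq (h : IsGapped B d κ u μ v s) :
    v 0 = (1 / weightedInner d (dualVec d v) (dualVec d v)) •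
      (dualVec d v - ((1 / (n : ℝ)) * (∑ j, dualVec d v j) / μ 0) • (1 : Fin n → ℝ)) := by
  have hμ := h.mu_zero_pos
  have hpos := weightedInner_self_pos h.rev.pos h.dualVec_ne_zero
  refine sub_eq_zero.1 (h.eq_zero_of_eigenvector ?_ ?_)
  · rw [Matrix.mulVec_sub, Matrix.mulVec_smul, Matrix.mulVec_sub, Matrix.mulVec_smul,
      h.rev.deflatedOf_mulVec_one, h.eigenD.eigen, deflatedOf_mulVec, h.lazyOf_dualVec]
    ext i
    simp only [Pi.sub_apply, Pi.smul_apply, smul_eq_mul, Pi.one_apply, Pi.zero_apply]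
    field_simp
    ring
  · rw [map_sub, map_smul, map_sub, map_smul]
    simp only [Finsupp.sub_apply, Finsupp.smul_apply, smul_eq_mul, h.repr_one,
      ← h.weightedInner_dualVec (dualVec d v)]
    rw [v.repr_self]
    simp only [Finsupp.single_eq_same]
    field_simp
    simp

/-- The first eigenvector of the deflated matrix is the second eigenvector of `B`, if the latter has
mean zero. -/
lemma basis_zero_eq_or (h : IsGapped B d κ u μ v s) (hu : ∑ k, u 1 k = 0) :
    v 0 = u 1 ∨ v 0 = -u 1 := by
  have h1 : (deflatedOf B).mulVec (u 1) = μ 0 • u 1 := by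
    rw [deflatedOf_mulVec, hu, lazyOf_mulVec, h.eigenB.eigen, h.mu_zero]
    ext i
    simp only [Pi.add_apply, Pi.sub_apply, Pi.smul_apply, smul_eq_mul, Pi.one_apply]
    ring
  have h2 : u 1 = v.repr (u 1) 0 • v 0 := by
    refine sub_eq_zero.1 (h.eq_zero_of_eigenvector ?_ ?_)
    · rw [Matrix.mulVec_sub, Matrix.mulVec_smul, h1, h.eigenD.eigen, smul_sub, smul_comm]
    · simp
  set a := v.repr (u 1) 0
  have h3 := h.eigenB.unit 1
  rw [h2] at h3
  simp only [Pi.smul_apply, smul_eq_mul, mul_pow, ← Finset.mul_sum, h.eigenD.unit, mul_one] at h3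
  rw [sq, mul_self_eq_one_iff] at h3
  rcases h3 with h4 | h4
  · left; rw [h2, h4, one_smul]
  · right; rw [h2, h4]; simp

end IsGapped

/-! ### Powers of the deflated matrix -/

/-- The Euclidean norm of a vector. -/
noncomputable def euclNorm {n : ℕ} (x : Fin n → ℝ) : ℝ := √(∑ k, x k ^ 2)

lemma euclNorm_nonneg {n : ℕ} (x : Fin n → ℝ) : 0 ≤ euclNorm x := Real.sqrt_nonneg _

lemma euclNorm_sq {n : ℕ} (x : Fin n → ℝ) : euclNorm x ^ 2 = ∑ k, x k ^ 2 :=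
  Real.sq_sqrt (Finset.sum_nonneg fun _ _ => sq_nonneg _)

lemma abs_le_euclNorm {n : ℕ} (x : Fin n → ℝ) (k : Fin n) : |x k| ≤ euclNorm x := by
  refine Real.abs_le_sqrt ?_
  exact Finset.single_le_sum (f := fun k => x k ^ 2) (fun _ _ => sq_nonneg _) (Finset.mem_univ k)

namespace IsGapped

variable {n : ℕ} [NeZero n] {B : Matrix (Fin n) (Fin n) ℝ} {d : Fin n → ℝ}
  {κ : Fin n → ℝ} {u : Module.Basis (Fin n) ℝ (Fin n → ℝ)}
  {μ : Fin n → ℝ} {v : Module.Basis (Fin n) ℝ (Fin n → ℝ)} {s : ℝ} {x y : Fin n → ℝ}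

/-- The projection of `x` to the weighted orthogonal complement of the constant vector and of the
dual vector. -/
noncomputable def remainder {n : ℕ} [NeZero n] (d : Fin n → ℝ)
    (v : Module.Basis (Fin n) ℝ (Fin n → ℝ)) (x : Fin n → ℝ) : Fin n → ℝ :=
  x - (weightedInner d 1 x / weightedInner d 1 1) • (1 : Fin n → ℝ)
    - (v.repr x 0 / weightedInner d (dualVec d v) (dualVec d v)) • dualVec d v

lemma weightedInner_one_remainder (h : IsGapped B d κ u μ v s) :
    weightedInner d 1 (remainder d v x) = 0 := by
  have hpos1 := weightedInner_self_pos h.rev.pos h.one_ne_zero'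
  rw [remainder, weightedInner_sub, weightedInner_sub, weightedInner_smul, weightedInner_smul,
    h.weightedInner_one_dualVec]
  field_simp
  ring

lemma weightedInner_dualVec_remainder (h : IsGapped B d κ u μ v s) :
    weightedInner d (dualVec d v) (remainder d v x) = 0 := by
  have hpos := weightedInner_self_pos h.rev.pos h.dualVec_ne_zero
  rw [remainder, weightedInner_sub, weightedInner_sub, weightedInner_smul, weightedInner_smul,
    weightedInner_comm (x := dualVec d v) (y := 1), h.weightedInner_one_dualVec, ← h.weightedInner_dualVec x]
  field_simp
  ring

lemma weightedInner_self_eq (h : IsGapped B d κ u μ v s) :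
    weightedInner d x x = weightedInner d (remainder d v x) (remainder d v x)
      + weightedInner d 1 x ^ 2 / weightedInner d 1 1
      + v.repr x 0 ^ 2 / weightedInner d (dualVec d v) (dualVec d v) := by
  have hpos1 := weightedInner_self_pos h.rev.pos h.one_ne_zero'
  have hpos := weightedInner_self_pos h.rev.pos h.dualVec_ne_zero
  have h1 := h.weightedInner_one_remainder (x := x)
  have h2 := h.weightedInner_dualVec_remainder (x := x)
  have h3 : weightedInner d (remainder d v x) (remainder d v x)
      = weightedInner d (remainder d v x) x := by
    conv_lhs => rw [remainder, weightedInner_sub, weightedInner_sub, weightedInner_smul,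
      weightedInner_smul, ← remainder, weightedInner_comm (x := remainder d v x) (y := 1), h1,
      weightedInner_comm (x := remainder d v x) (y := dualVec d v), h2]
    ring
  rw [h3]
  conv_rhs => rw [remainder, weightedInner_sub_left, weightedInner_sub_left,
    weightedInner_smul_left, weightedInner_smul_left, h.weightedInner_dualVec x]
  field_simp
  ring

lemma weightedInner_self_le_card (h : IsGapped B d κ u μ v s) :
    weightedInner d x x ≤ n * euclNorm x ^ 2 := by
  rw [euclNorm_sq, Finset.mul_sum]
  refine Finset.sum_le_sum fun k _ => ?_
  have := mul_le_mul_of_nonneg_right (h.rev.le_card k) (sq_nonneg (x k))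
  linarith

lemma weightedInner_remainder_le (h : IsGapped B d κ u μ v s) :
    weightedInner d (remainder d v x) (remainder d v x) ≤ n * euclNorm x ^ 2 := by
  have hpos1 := weightedInner_self_pos h.rev.pos h.one_ne_zero'
  have hpos := weightedInner_self_pos h.rev.pos h.dualVec_ne_zero
  have h1 := h.weightedInner_self_eq (x := x)
  have h2 : 0 ≤ weightedInner d 1 x ^ 2 / weightedInner d 1 1 := by positivity
  have h3 : 0 ≤ v.repr x 0 ^ 2 / weightedInner d (dualVec d v) (dualVec d v) := by positivity
  linarith [h.weightedInner_self_le_card (x := x)]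

/-- Together with `weightedInner_self_le_card` this is smoothing without loss: passing to the
weighted norm costs a factor `√n`, and one application of `B` regains it because all degrees are at
least `√n`. -/
lemma sq_mulVec_le (h : IsGapped B d κ u μ v s) {M : ℝ}
    (hM : weightedInner d y y ≤ M * n) (i : Fin n) : (B.mulVec y i) ^ 2 ≤ M := by
  have hn : (0 : ℝ) < n := by exact_mod_cast i.pos
  have h1 := h.rev.sq_mulVec_le (x := y) (m := √n) (Real.sqrt_pos.2 hn)
    (fun j => Real.sqrt_le_iff.2 ⟨(h.rev.pos j).le, h.le_sq j⟩) i
  rw [Real.sq_sqrt hn.le] at h1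
  exact h1.trans ((div_le_iff₀ hn).2 hM)

/-- The component along `dualVec` is its own image under `B` divided by `κ 1 ≥ s - 1 > 0`, so
smoothing bounds its entries. -/
lemma abs_coeff_mul_dualVec_le (h : IsGapped B d κ u μ v s) (i : Fin n) :
    |v.repr x 0 / weightedInner d (dualVec d v) (dualVec d v) * dualVec d v i|
      ≤ euclNorm x / (s - 1) := by
  have hs := h.one_lt
  have hk : s - 1 ≤ κ 1 := by linarith [h.le_kappa_one]
  have hpos1 := weightedInner_self_pos h.rev.pos h.one_ne_zero'
  have hpos := weightedInner_self_pos h.rev.pos h.dualVec_ne_zero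
  set b := v.repr x 0 / weightedInner d (dualVec d v) (dualVec d v) with hb
  have h1 : weightedInner d (b • dualVec d v) (b • dualVec d v) ≤ euclNorm x ^ 2 * n := by
    rw [weightedInner_smul, weightedInner_smul_left]
    have h2 := h.weightedInner_self_eq (x := x)
    have h3 : 0 ≤ weightedInner d 1 x ^ 2 / weightedInner d 1 1 := by positivity
    have h4 := weightedInner_self_nonneg (x := remainder d v x) h.rev.pos
    have h5 : b * (b * weightedInner d (dualVec d v) (dualVec d v))
        = v.repr x 0 ^ 2 / weightedInner d (dualVec d v) (dualVec d v) := by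
      rw [hb]; field_simp
    linarith [h.weightedInner_self_le_card (x := x)]
  have h2 := h.sq_mulVec_le h1 i
  have h3 : B.mulVec (b • dualVec d v) i = κ 1 * (b * dualVec d v i) := by
    rw [Matrix.mulVec_smul, h.mulVec_dualVec, h.mu_zero]
    simp only [Pi.smul_apply, smul_eq_mul]
    ring
  rw [h3] at h2
  have h4 := abs_le_of_sq_le_sq h2 (euclNorm_nonneg x)
  rw [abs_mul, abs_of_pos (by linarith : 0 < κ 1)] at h4
  rw [le_div_iff₀ (by linarith), mul_comm]
  exact (mul_le_mul_of_nonneg_right hk (abs_nonneg _)).trans h4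

lemma abs_remainder_le (h : IsGapped B d κ u μ v s) (i : Fin n) :
    |remainder d v x i| ≤ (2 + 1 / (s - 1)) * euclNorm x := by
  have hpos1 := weightedInner_self_pos h.rev.pos h.one_ne_zero'
  have h1 := abs_le_euclNorm x i
  have h2 := h.abs_coeff_mul_dualVec_le (x := x) i
  have h3 : |weightedInner d 1 x / weightedInner d 1 1| ≤ euclNorm x := by
    rw [abs_div, abs_of_pos hpos1, div_le_iff₀ hpos1]
    simp only [weightedInner, Pi.one_apply, mul_one, Finset.mul_sum]
    refine (Finset.abs_sum_le_sum_abs _ _).trans (Finset.sum_le_sum fun k _ => ?_)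
    rw [abs_mul, abs_of_pos (h.rev.pos k), mul_comm]
    exact mul_le_mul_of_nonneg_right (abs_le_euclNorm x k) (h.rev.pos k).le
  simp only [remainder, Pi.sub_apply, Pi.smul_apply, smul_eq_mul, Pi.one_apply, mul_one]
  refine (abs_sub _ _).trans ?_
  have h4 := abs_sub (x i) (weightedInner d 1 x / weightedInner d 1 1)
  have h5 : (2 + 1 / (s - 1)) * euclNorm x = euclNorm x + euclNorm x + euclNorm x / (s - 1) := by
    ring
  linarith

lemma lazyOf_pow_remainder (h : IsGapped B d κ u μ v s) (k : ℕ) :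
    weightedInner d 1 ((lazyOf B ^ k).mulVec (remainder d v x)) = 0 ∧
    weightedInner d (dualVec d v) ((lazyOf B ^ k).mulVec (remainder d v x)) = 0 ∧
    weightedInner d ((lazyOf B ^ k).mulVec (remainder d v x))
      ((lazyOf B ^ k).mulVec (remainder d v x)) ≤ ((μ 0 / s ^ 2) ^ k * euclNorm x) ^ 2 * n := by
  induction k with
  | zero =>
    simp only [pow_zero, Matrix.one_mulVec, one_mul]
    exact ⟨h.weightedInner_one_remainder, h.weightedInner_dualVec_remainder,
      by linarith [h.weightedInner_remainder_le (x := x)]⟩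
  | succ k ih =>
    obtain ⟨h1, h2, h3⟩ := ih
    rw [pow_succ', ← Matrix.mulVec_mulVec]
    refine ⟨?_, ?_, ?_⟩
    · rw [h.rev.weightedInner_one_lazyOf, h1]
    · rw [h.rev.weightedInner_lazyOf_mulVec, h.lazyOf_dualVec, weightedInner_smul_left, h2,
        mul_zero]
    · refine (h.contraction h1 h2).trans ?_
      calc _ ≤ (μ 0 / s ^ 2) ^ 2 * (((μ 0 / s ^ 2) ^ k * euclNorm x) ^ 2 * n) :=
            mul_le_mul_of_nonneg_left h3 (sq_nonneg _)
        _ = _ := by ring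

lemma half_le_div (h : IsGapped B d κ u μ v s) : 1 / 2 ≤ μ 0 / s := by
  have hs := h.one_lt
  rw [le_div_iff₀ (by linarith)]
  linarith [h.le_two_mu_zero]

/-- Each lazy step averages the previous vector, bounded entrywise by induction, with its image
under `B`, bounded by smoothing and the weighted contraction. The averaging factor `1/2` is at most
`μ 0 / s`, so each step adds only `1` to the prefactor. -/
lemma abs_lazyOf_pow_remainder_le (h : IsGapped B d κ u μ v s) (k : ℕ) (i : Fin n) :
    |(lazyOf B ^ k).mulVec (remainder d v x) i|
      ≤ (2 + 1 / (s - 1) + k) * (μ 0 / s) ^ k * euclNorm x := by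
  have hs := h.one_lt
  have hμ := h.mu_zero_pos
  have hβ := h.half_le_div
  induction k generalizing i with
  | zero => simpa using h.abs_remainder_le i
  | succ k ih =>
    rw [pow_succ', ← Matrix.mulVec_mulVec, lazyOf_mulVec]
    have h2 := h.sq_mulVec_le (h.lazyOf_pow_remainder (x := x) k).2.2 i
    have h3 := abs_le_of_sq_le_sq h2 (mul_nonneg (by positivity) (euclNorm_nonneg x))
    have h4 : (μ 0 / s ^ 2) ^ k ≤ (μ 0 / s) ^ k := by
      refine pow_le_pow_left₀ (by positivity) ?_ k
      exact div_le_div_of_nonneg_left hμ.le (by linarith) (by nlinarith)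
    have h5 := mul_le_mul_of_nonneg_right h4 (euclNorm_nonneg x)
    simp only [Pi.add_apply, Pi.smul_apply, smul_eq_mul]
    set P := (μ 0 / s) ^ k * euclNorm x with hP
    have hP0 : 0 ≤ P := mul_nonneg (by positivity) (euclNorm_nonneg x)
    set K := 2 + 1 / (s - 1) + (k : ℝ) with hK
    have hK0 : 0 ≤ K := by
      have : 0 < s - 1 := by linarith
      positivity
    have hKP : 0 ≤ K * P + P := by positivity
    have h6 := ih i
    rw [mul_assoc, ← hP] at h6
    calc _ ≤ |1 / 2 * (lazyOf B ^ k).mulVec (remainder d v x) i|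
          + |1 / 2 * B.mulVec ((lazyOf B ^ k).mulVec (remainder d v x)) i| := abs_add_le _ _
      _ ≤ 1 / 2 * (K * P + P) := by
          rw [abs_mul, abs_mul, abs_of_pos (by norm_num : (0 : ℝ) < 1 / 2)]
          linarith
      _ ≤ μ 0 / s * (K * P + P) := mul_le_mul_of_nonneg_right hβ hKP
      _ = _ := by
          rw [hP, hK]; push_cast; ring

lemma deflatedOf_pow_one (h : IsGapped B d κ u μ v s) (k : ℕ) (c : ℝ) :
    (deflatedOf B ^ (k + 1)).mulVec (c • 1) = 0 := by
  rw [pow_succ, ← Matrix.mulVec_mulVec, Matrix.mulVec_smul, h.rev.deflatedOf_mulVec_one, smul_zero,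
    Matrix.mulVec_zero]

/-- Each mean subtracted on the way is a constant vector, which the next deflated step kills; only
the last subtraction survives. -/
lemma deflatedOf_pow_succ_mulVec (h : IsGapped B d κ u μ v s) (k : ℕ) (x : Fin n → ℝ) :
    (deflatedOf B ^ (k + 1)).mulVec x = (deflatedOf B).mulVec ((lazyOf B ^ k).mulVec x) := by
  induction k generalizing x with
  | zero => simp
  | succ k ih =>
    rw [pow_succ, ← Matrix.mulVec_mulVec, deflatedOf_mulVec, Matrix.mulVec_sub,
      h.deflatedOf_pow_one, sub_zero, ih, Matrix.mulVec_mulVec (M := lazyOf B ^ k), ← pow_succ]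

lemma abs_deflatedOf_pow_remainder_le (h : IsGapped B d κ u μ v s) (k : ℕ) (i : Fin n) :
    |(deflatedOf B ^ (k + 1)).mulVec (remainder d v x) i|
      ≤ 4 * (2 + 1 / (s - 1) + (k + 1 : ℕ)) * (μ 0 / s) ^ (k + 1) * euclNorm x := by
  have hs := h.one_lt
  have hμ := h.mu_zero_pos
  have hs1 : 0 < s - 1 := by linarith
  have hβ := h.half_le_div
  have hN := euclNorm_nonneg x
  rw [h.deflatedOf_pow_succ_mulVec]
  refine (h.rev.abs_deflatedOf_mulVec_le (h.abs_lazyOf_pow_remainder_le (x := x) k) i).trans ?_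
  have h1 : (2 + 1 / (s - 1) + k) * (1 / 2) ≤ (2 + 1 / (s - 1) + (k + 1 : ℕ)) * (μ 0 / s) := by
    refine mul_le_mul ?_ hβ (by norm_num) (by positivity)
    push_cast
    linarith
  calc 2 * ((2 + 1 / (s - 1) + k) * (μ 0 / s) ^ k * euclNorm x)
      = 4 * (((2 + 1 / (s - 1) + k) * (1 / 2)) * ((μ 0 / s) ^ k * euclNorm x)) := by ring
    _ ≤ 4 * (((2 + 1 / (s - 1) + (k + 1 : ℕ)) * (μ 0 / s)) * ((μ 0 / s) ^ k * euclNorm x)) := by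
        gcongr
    _ = _ := by ring

lemma deflatedOf_pow_basis (h : IsGapped B d κ u μ v s) (k : ℕ) (j : Fin n) :
    (deflatedOf B ^ k).mulVec (v j) = μ j ^ k • v j := by
  induction k with
  | zero => simp
  | succ k ih =>
    rw [pow_succ', ← Matrix.mulVec_mulVec, ih, Matrix.mulVec_smul, h.eigenD.eigen, smul_smul,
      pow_succ]

/-- Powers of the deflated matrix are close to their leading term. -/
lemma abs_deflatedOf_pow_sub_le (h : IsGapped B d κ u μ v s) {k : ℕ} (hk : k ≠ 0) (i : Fin n) :
    |(deflatedOf B ^ k).mulVec x i - v.repr x 0 * μ 0 ^ k * v 0 i|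
      ≤ 4 * (2 + 1 / (s - 1) + k) * (μ 0 / s) ^ k * euclNorm x := by
  obtain ⟨k, rfl⟩ := Nat.exists_eq_succ_of_ne_zero hk
  have hv := h.basis_zero_eq
  -- By `basis_zero_eq`, the component along `dualVec` equals the one along `v 0` up to a constant
  -- vector. Constants vanish after one step, which is why `k ≠ 0` is required.
  have h1 : x = remainder d v x + v.repr x 0 • v 0
      + (weightedInner d 1 x / weightedInner d 1 1 + v.repr x 0
          / weightedInner d (dualVec d v) (dualVec d v)
            * ((1 / (n : ℝ)) * (∑ j, dualVec d v j) / μ 0)) • (1 : Fin n → ℝ) := by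
    ext j
    have hvj := congrFun hv j
    simp only [remainder, Pi.sub_apply, Pi.smul_apply, smul_eq_mul, Pi.one_apply, mul_one,
      Pi.add_apply] at hvj ⊢
    rw [hvj]
    ring
  have h2 : (deflatedOf B ^ (k + 1)).mulVec x i - v.repr x 0 * μ 0 ^ (k + 1) * v 0 i
      = (deflatedOf B ^ (k + 1)).mulVec (remainder d v x) i := by
    conv_lhs => rw [h1]
    rw [Matrix.mulVec_add, Matrix.mulVec_add, h.deflatedOf_pow_one, Matrix.mulVec_smul,
      h.deflatedOf_pow_basis, ← h1]
    simp only [Pi.add_apply, Pi.smul_apply, smul_eq_mul, Pi.zero_apply]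
    ring
  rw [h2]
  exact h.abs_deflatedOf_pow_remainder_le k i

lemma abs_repr_mul_basis_zero_le (h : IsGapped B d κ u μ v s) (i : Fin n) :
    |v.repr x 0 * v 0 i| ≤ 3 / (s - 1) * euclNorm x := by
  have hs := h.one_lt
  have hμ := h.le_two_mu_zero
  have hn : (0 : ℝ) < n := by exact_mod_cast i.pos
  have hvi := congrFun h.basis_zero_eq i
  set b := v.repr x 0 / weightedInner d (dualVec d v) (dualVec d v) with hb
  have h0 : v.repr x 0 * v 0 i
      = b * dualVec d v i - (1 / μ 0) * ((1 / (n : ℝ)) * ∑ j, b * dualVec d v j) := by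
    rw [hvi, ← Finset.mul_sum]
    simp only [Pi.sub_apply, Pi.smul_apply, smul_eq_mul, Pi.one_apply, mul_one]
    rw [hb]
    ring
  have h1 : |(1 / (n : ℝ)) * ∑ j, b * dualVec d v j| ≤ euclNorm x / (s - 1) := by
    rw [abs_mul, abs_of_pos (by positivity)]
    calc 1 / (n : ℝ) * |∑ j, b * dualVec d v j|
        ≤ 1 / (n : ℝ) * ∑ _j : Fin n, euclNorm x / (s - 1) :=
          mul_le_mul_of_nonneg_left ((Finset.abs_sum_le_sum_abs _ _).trans
            (Finset.sum_le_sum fun j _ => h.abs_coeff_mul_dualVec_le (x := x) j)) (by positivity)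
      _ = euclNorm x / (s - 1) := by
          simp only [Finset.sum_const, Finset.card_univ, Fintype.card_fin, nsmul_eq_mul]
          field_simp
  have h2 : 1 / μ 0 ≤ 2 := by
    rw [div_le_iff₀ h.mu_zero_pos]; linarith
  have h3 : |(1 / μ 0) * ((1 / (n : ℝ)) * ∑ j, b * dualVec d v j)|
      ≤ 2 * (euclNorm x / (s - 1)) := by
    rw [abs_mul, abs_of_pos (one_div_pos.2 h.mu_zero_pos)]
    exact mul_le_mul h2 h1 (abs_nonneg _) (by norm_num)
  rw [h0]
  refine (abs_sub _ _).trans ?_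
  have h4 := h.abs_coeff_mul_dualVec_le (x := x) i
  have h5 : 3 / (s - 1) * euclNorm x = 3 * (euclNorm x / (s - 1)) := by ring
  linarith

/-- The normalized powers of the deflated matrix have bounded rows. -/
lemma abs_deflatedOf_pow_le (h : IsGapped B d κ u μ v s) (k : ℕ) (i : Fin n) :
    |(deflatedOf B ^ k).mulVec x i| ≤ (8 + 11 / (s - 1)) * μ 0 ^ k * euclNorm x := by
  have hs := h.one_lt
  have hs1 : 0 < s - 1 := by linarith
  have hμ := h.mu_zero_pos
  have hN := euclNorm_nonneg x
  rcases eq_or_ne k 0 with rfl | hk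
  · have h1 := abs_le_euclNorm x i
    have h2 : 0 ≤ 11 / (s - 1) := by positivity
    simp only [pow_zero, Matrix.one_mulVec, mul_one]
    nlinarith
  have h1 := h.abs_deflatedOf_pow_sub_le (x := x) hk i
  have h2 := h.abs_repr_mul_basis_zero_le (x := x) i
  have hspos : 0 < s ^ k := by positivity
  -- Bernoulli's inequality: `s ^ k` absorbs the prefactor that is linear in `k`, so the row bound
  -- is uniform in `k`.
  have hbern : 1 + k * (s - 1) ≤ s ^ k := by
    have := one_add_mul_le_pow (a := s - 1) (by linarith) k
    simpa using this
  have h3 : (2 + 1 / (s - 1) + k) / s ^ k ≤ 2 + 2 / (s - 1) := by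
    rw [div_le_iff₀ hspos]
    have hk1 : (k : ℝ) ≤ 1 / (s - 1) * s ^ k := by
      rw [one_div, inv_mul_eq_div, le_div_iff₀ hs1]
      linarith
    have hone : 1 ≤ s ^ k := one_le_pow₀ hs.le
    have : (2 + 1 / (s - 1)) * 1 ≤ (2 + 1 / (s - 1)) * s ^ k :=
      mul_le_mul_of_nonneg_left hone (by positivity)
    calc _ ≤ (2 + 1 / (s - 1)) * s ^ k + 1 / (s - 1) * s ^ k := by linarith
      _ = _ := by ring
  have h4 : 4 * (2 + 1 / (s - 1) + k) * (μ 0 / s) ^ k * euclNorm x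
      ≤ (8 + 8 / (s - 1)) * μ 0 ^ k * euclNorm x := by
    calc _ = 4 * ((2 + 1 / (s - 1) + k) / s ^ k) * μ 0 ^ k * euclNorm x := by
          rw [div_pow]; ring
      _ ≤ 4 * (2 + 2 / (s - 1)) * μ 0 ^ k * euclNorm x := by gcongr
      _ = _ := by ring
  have h5 : |v.repr x 0 * μ 0 ^ k * v 0 i| ≤ 3 / (s - 1) * μ 0 ^ k * euclNorm x := by
    have : v.repr x 0 * μ 0 ^ k * v 0 i = μ 0 ^ k * (v.repr x 0 * v 0 i) := by ring
    rw [this, abs_mul, abs_of_pos (by positivity)]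
    calc _ ≤ μ 0 ^ k * (3 / (s - 1) * euclNorm x) := by gcongr
      _ = _ := by ring
  have h6 := abs_add_le ((deflatedOf B ^ k).mulVec x i - v.repr x 0 * μ 0 ^ k * v 0 i)
    (v.repr x 0 * μ 0 ^ k * v 0 i)
  rw [sub_add_cancel] at h6
  have h7 : (8 + 11 / (s - 1)) * μ 0 ^ k * euclNorm x = (8 + 8 / (s - 1)) * μ 0 ^ k * euclNorm x
      + 3 / (s - 1) * μ 0 ^ k * euclNorm x := by ring
  linarith

end IsGapped

/-! ### Graphs -/

section Graph

variable {n : ℕ} (G : SimpleGraph (Fin n))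

open Classical in
lemma isReversible_transitionMatrix (h : ∀ i, 0 < G.degree i) :
    IsReversible (transitionMatrix G) fun i => (G.degree i : ℝ) := by
  have hd : ∀ i, (0 : ℝ) < G.degree i := fun i => by exact_mod_cast h i
  have hmul : ∀ i j, (G.degree i : ℝ) * transitionMatrix G i j = G.adjMatrix ℝ i j := fun i j => by
    rw [transitionMatrix, Matrix.of_apply, mul_div_cancel₀ _ (hd i).ne']
  refine ⟨hd, fun i j => ?_, fun i j => ?_, fun i => ?_, fun i j => ?_, fun i => ?_⟩
  · rw [hmul, hmul, SimpleGraph.adjMatrix_apply, SimpleGraph.adjMatrix_apply, G.adj_comm]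
  · rw [transitionMatrix, Matrix.of_apply, SimpleGraph.adjMatrix_apply]
    positivity
  · simp only [transitionMatrix, Matrix.of_apply]
    rw [← Finset.sum_div]
    have := G.adjMatrix_mulVec_const_apply (α := ℝ) (a := 1) (v := i)
    simp only [Matrix.mulVec, dotProduct, Function.const_apply, mul_one] at this
    rw [this, div_self (hd i).ne']
  · rw [hmul, SimpleGraph.adjMatrix_apply]
    split_ifs <;> norm_num
  · simp [transitionMatrix]

open Classical in
lemma transitionMatrix_mulVec (x : Fin n → ℝ) (i : Fin n) :
    (transitionMatrix G).mulVec x i = ∑ j ∈ G.neighborFinset i, x j / (G.degree i : ℝ) := by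
  rw [← Finset.sum_div, ← SimpleGraph.adjMatrix_mulVec_apply]
  simp only [Matrix.mulVec, dotProduct, transitionMatrix, Matrix.of_apply, Finset.sum_div]
  exact Finset.sum_congr rfl fun j _ => by ring

lemma deflatedMatrix_eq : deflatedMatrix G = deflatedOf (transitionMatrix G) := rfl

end Graph

/-! ### The iterates without clipping and without additional edges -/

section Run

variable {n T : ℕ} {G : SimpleGraph (Fin n)} {ε : ℝ} {c : WithTop ℝ} {ω : Sample n T}

open Classical in
lemma adjacencyList_eq (i : Fin n) (h : degreeEstimate G ε ω ≤ G.degree i) :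
    adjacencyList G ε ω i = G.neighborFinset i := by
  refine List.foldl_fixed' (fun j => if_neg ?_) _
  rw [G.card_neighborFinset_eq_degree]
  exact not_lt.2 h

lemma clip_eq_self {b w N : ℝ} (hc : ((N : ℝ) : WithTop ℝ) ≤ c) (hb : 0 ≤ b) (hw : |w| ≤ N * b) :
    clip c b w = w := by
  cases c with
  | top => rfl
  | coe c =>
    have h1 : N * b ≤ c * b := mul_le_mul_of_nonneg_right (WithTop.coe_le_coe.1 hc) hb
    have h2 := abs_le.1 hw
    show (if c * b < w then c * b else if w < -(c * b) then -(c * b) else w) = w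
    rw [if_neg (by linarith [h2.2]), if_neg (by linarith [h2.1])]

lemma abs_le_iSup_abs (x : Fin n → ℝ) (j : Fin n) : |x j| ≤ ⨆ k, |x k| :=
  le_ciSup (f := fun k => |x k|) (Set.finite_range _).bddAbove j

lemma iSup_abs_nonneg (x : Fin n → ℝ) : 0 ≤ ⨆ k, |x k| :=
  Real.iSup_nonneg fun _ => abs_nonneg _

lemma noiseScale_nonneg (hε : 0 < ε) (hδ : 0 < degreeEstimate G ε ω) (x : Fin n → ℝ) :
    0 ≤ noiseScale G ε ω x := by
  have := iSup_abs_nonneg x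
  rw [noiseScale]
  positivity

lemma noiseScale_le [NeZero n] (hε : 0 < ε) {δ M : ℝ} (hδ : 0 < δ)
    (hδ' : δ ≤ degreeEstimate G ε ω) {x : Fin n → ℝ} (hM : ∀ j, |x j| ≤ M) :
    noiseScale G ε ω x ≤ 5 * T / (9 * ε * δ) * M := by
  have h0 := iSup_abs_nonneg x
  have h1 : ⨆ j, |x j| ≤ M := ciSup_le hM
  calc noiseScale G ε ω x ≤ 5 * T / (9 * ε) * (M / δ) := by
        refine mul_le_mul_of_nonneg_left ?_ (by positivity)
        exact div_le_div₀ (h0.trans h1) h1 hδ hδ'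
    _ = _ := by rw [div_mul_div_comm, mul_div_right_comm]

open Classical in
/-- If the lists are not enlarged, then nothing is clipped. -/
lemma iterates_succ [NeZero n] (hε : 0 < ε) (hd : ∀ i, 0 < G.degree i)
    (hc : ((n : ℝ) : WithTop ℝ) ≤ c) (hδ : 0 < degreeEstimate G ε ω)
    (hδd : ∀ i, degreeEstimate G ε ω ≤ G.degree i) (hT : 36 * ε ≤ 5 * T)
    (hZ : ∀ t i, |ω.2.2.2 t i| ≤ n / 2) (t : Fin T) :
    iterates G ε c ω (t + 1)
      = (deflatedMatrix G).mulVec (iterates G ε c ω t) + noise G ε c ω t := by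
  have hB := isReversible_transitionMatrix G hd
  ext i
  set x := iterates G ε c ω t with hx
  have hb := noiseScale_nonneg (G := G) (ω := ω) hε hδ x
  have hstep : iterates G ε c ω (t + 1) i = clip c (noiseScale G ε ω x)
      ((deflatedMatrix G).mulVec x i + noise G ε c ω t i) := by
    rw [iterates]
    beta_reduce
    rw [dif_pos t.2, ← hx, adjacencyList_eq i (hδd i), G.card_neighborFinset_eq_degree,
      ← transitionMatrix_mulVec, deflatedMatrix_eq, deflatedOf_mulVec, lazyOf_mulVec, noise]
    simp only [Pi.add_apply, Pi.sub_apply, Pi.smul_apply, smul_eq_mul, Pi.one_apply, mul_one,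
      ← hx]
  rw [hstep]
  refine clip_eq_self hc hb ?_
  have h1 := hB.abs_deflatedOf_mulVec_le (abs_le_iSup_abs x) i
  rw [← deflatedMatrix_eq] at h1
  have h2 : |noise G ε c ω t i| ≤ n / 2 * noiseScale G ε ω x := by
    rw [noise, ← hx, abs_mul, abs_of_nonneg hb, mul_comm]
    exact mul_le_mul_of_nonneg_right (hZ t i) hb
  -- The noise scale itself dominates the drift: `degreeEstimate` is at most `n` and `5T / (9ε) ≥
  -- 4`, so it is at least `4 / n` times the maximum. Drift and noise each use half of the clipping
  -- range.
  have h3 : 2 * ⨆ j, |x j| ≤ n / 2 * noiseScale G ε ω x := by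
    have hδn := (hδd i).trans (hB.le_card i)
    have hM := iSup_abs_nonneg x
    have hq : 4 ≤ 5 * (T : ℝ) / (9 * ε) := by
      rw [le_div_iff₀ (by positivity)]
      linarith
    have h4 : ⨆ j, |x j| ≤ n * ((⨆ j, |x j|) / degreeEstimate G ε ω) := by
      rw [mul_div_assoc', le_div_iff₀ hδ, mul_comm]
      exact mul_le_mul_of_nonneg_right hδn hM
    calc 2 * ⨆ j, |x j| ≤ 2 * (n * ((⨆ j, |x j|) / degreeEstimate G ε ω)) := by linarith
      _ = n / 2 * (4 * ((⨆ j, |x j|) / degreeEstimate G ε ω)) := by ring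
      _ ≤ n / 2 * noiseScale G ε ω x := by
        rw [noiseScale]
        gcongr
  refine (abs_add_le _ _).trans ?_
  linarith

end Run

/-! ### Affine recursions -/

section Recursion

variable {n T : ℕ} {D : Matrix (Fin n) (Fin n) ℝ} {X Z : ℕ → Fin n → ℝ} {C : ℕ → ℝ}

/-- Discrete Duhamel formula. -/
lemma eq_sum_of_recursion (hX : ∀ t < T, X (t + 1) = D.mulVec (X t) + C t • Z t) {t : ℕ}
    (ht : t ≤ T) :
    X t = (D ^ t).mulVec (X 0) + ∑ k ∈ Finset.range t, C k • (D ^ (t - (k + 1))).mulVec (Z k) := by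
  induction t with
  | zero => simp
  | succ t ih =>
    rw [hX t ht, ih (by omega), Matrix.mulVec_add, Matrix.mulVec_mulVec, ← pow_succ',
      Finset.sum_range_succ, add_assoc]
    congr 1
    have h1 := map_sum D.mulVecLin (fun k => C k • (D ^ (t - (k + 1))).mulVec (Z k))
      (Finset.range t)
    simp only [Matrix.mulVecLin_apply] at h1
    rw [h1]
    congr 1
    · refine Finset.sum_congr rfl fun k hk => ?_
      have hk' := Finset.mem_range.1 hk
      rw [Matrix.mulVec_smul, Matrix.mulVec_mulVec, ← pow_succ',
        show t - (k + 1) + 1 = t + 1 - (k + 1) by omega]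
    · simp

/-- The iterates of an affine recursion with small noise grow as those of the linear one. -/
lemma abs_le_of_recursion {K l M R q : ℝ} (hK : 0 ≤ K) (hl : 0 < l) (hM : 0 ≤ M)
    (hX : ∀ t < T, X (t + 1) = D.mulVec (X t) + C t • Z t)
    (hD : ∀ (k : ℕ) (x : Fin n → ℝ) (i : Fin n), |(D ^ k).mulVec x i| ≤ K * l ^ k * euclNorm x)
    (h0 : ∀ t ≤ T, ∀ i, |(D ^ t).mulVec (X 0) i| ≤ M * l ^ t)
    (hZ : ∀ t < T, euclNorm (Z t) ≤ R) (hC0 : ∀ t, 0 ≤ C t)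
    (hC : ∀ t M', (∀ i, |X t i| ≤ M') → C t ≤ q * M') (hq : T * K * R * q * 2 ≤ l)
    {t : ℕ} (ht : t ≤ T) (i : Fin n) : |X t i| ≤ 2 * M * l ^ t := by
  induction t using Nat.strong_induction_on generalizing i with
  | _ t ih =>
    rw [eq_sum_of_recursion hX ht, Pi.add_apply, Finset.sum_apply]
    -- The powers of `l` combine to `l ^ (t - 1)` because each noise term skips one step; the
    -- missing factor `l` is supplied by `hq`.
    have h1 : ∀ k ∈ Finset.range t, |(C k • (D ^ (t - (k + 1))).mulVec (Z k)) i|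
        ≤ K * R * q * 2 * M * l ^ (t - 1) := by
      intro k hk
      have hk' := Finset.mem_range.1 hk
      have h2 := hC k _ fun j => ih k hk' (by omega) j
      have h3 := hD (t - (k + 1)) (Z k) i
      rw [Pi.smul_apply, smul_eq_mul, abs_mul, abs_of_nonneg (hC0 k)]
      have h4 : K * l ^ (t - (k + 1)) * euclNorm (Z k) ≤ K * l ^ (t - (k + 1)) * R :=
        mul_le_mul_of_nonneg_left (hZ k (by omega)) (by positivity)
      calc _ ≤ q * (2 * M * l ^ k) * (K * l ^ (t - (k + 1)) * R) :=
            mul_le_mul h2 (h3.trans h4) (abs_nonneg _) ((hC0 k).trans h2)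
        _ = K * R * q * 2 * M * (l ^ k * l ^ (t - (k + 1))) := by ring
        _ = _ := by rw [← pow_add, show k + (t - (k + 1)) = t - 1 by omega]
    have h5 : |∑ k ∈ Finset.range t, (C k • (D ^ (t - (k + 1))).mulVec (Z k)) i| ≤ M * l ^ t := by
      refine (Finset.abs_sum_le_sum_abs _ _).trans ((Finset.sum_le_sum h1).trans ?_)
      rw [Finset.sum_const, Finset.card_range, nsmul_eq_mul]
      rcases t with _ | t
      · simpa using hM
      -- No sign of `R` or `q` is assumed; if the product is negative, the bound on the noise sum is
      -- trivial.
      by_cases hKR : 0 ≤ K * R * q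
      · have htT : ((t + 1 : ℕ) : ℝ) ≤ T := by exact_mod_cast ht
        calc ((t + 1 : ℕ) : ℝ) * (K * R * q * 2 * M * l ^ (t + 1 - 1))
            ≤ T * (K * R * q * 2 * M * l ^ (t + 1 - 1)) :=
              mul_le_mul_of_nonneg_right htT (by positivity)
          _ = (T * K * R * q * 2) * (M * l ^ t) := by rw [Nat.add_sub_cancel]; ring
          _ ≤ l * (M * l ^ t) := mul_le_mul_of_nonneg_right hq (by positivity)
          _ = _ := by ring
      · push Not at hKR
        have h6 : K * R * q * (2 * M * l ^ t) ≤ 0 :=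
          mul_nonpos_of_nonpos_of_nonneg hKR.le (by positivity)
        have h7 : ((t + 1 : ℕ) : ℝ) * (K * R * q * (2 * M * l ^ t)) ≤ 0 :=
          mul_nonpos_of_nonneg_of_nonpos (by positivity) h6
        have h8 : 0 ≤ M * l ^ (t + 1) := by positivity
        rw [Nat.add_sub_cancel]
        linarith
    refine (abs_add_le _ _).trans ?_
    linarith [h0 t ht i]

end Recursion

/-! ### The run of the algorithm on a good event -/

section Run

variable {n T : ℕ} [NeZero n] {G : SimpleGraph (Fin n)} {ε : ℝ} {c : WithTop ℝ} {ω : Sample n T}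
  {d κ : Fin n → ℝ} {u : Module.Basis (Fin n) ℝ (Fin n → ℝ)}
  {μ : Fin n → ℝ} {v : Module.Basis (Fin n) ℝ (Fin n → ℝ)} {s : ℝ}

/-- Summing over the whole basis removes the eigenvectors from view, so neither their conditioning
nor the signs of the smaller eigenvalues matter. -/
lemma IsGapped.sum_repr_mul_pow (h : IsGapped (transitionMatrix G) d κ u μ v s) (x : Fin n → ℝ)
    (k : ℕ) (i : Fin n) :
    ∑ j, v.repr x j * μ j ^ k * v j i = (deflatedMatrix G ^ k).mulVec x i := by
  have h1 := map_sum (deflatedMatrix G ^ k).mulVecLin (fun j => v.repr x j • v j) Finset.univ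
  simp only [Matrix.mulVecLin_apply, Matrix.mulVec_smul, v.sum_repr] at h1
  rw [h1, Finset.sum_apply]
  refine Finset.sum_congr rfl fun j _ => ?_
  rw [deflatedMatrix_eq, h.deflatedOf_pow_basis, Pi.smul_apply, Pi.smul_apply, smul_eq_mul,
    smul_eq_mul, mul_assoc]

lemma IsGapped.sum_finalCoeff (h : IsGapped (transitionMatrix G) d κ u μ v s) (i : Fin n) :
    ∑ j, finalCoeff G ε c ω μ v j * v j i = (deflatedMatrix G ^ T).mulVec ω.2.2.1 i
      + ∑ t : Fin T, (deflatedMatrix G ^ (T - (t + 1))).mulVec (noise G ε c ω t) i := by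
  simp only [finalCoeff, initCoeff, noiseCoeff, add_mul, Finset.sum_add_distrib, Finset.sum_mul]
  rw [h.sum_repr_mul_pow, Finset.sum_comm]
  congr 1
  exact Finset.sum_congr rfl fun t _ => h.sum_repr_mul_pow _ _ _

open Classical in
/-- The conclusion of the theorem holds whenever the degree estimate is correct and the random
vectors have typical size. -/
lemma IsGapped.run (h : IsGapped (transitionMatrix G) d κ u μ v s) (hε : 0 < ε)
    (hd : ∀ i, 0 < G.degree i) (hc : ((n : ℝ) : WithTop ℝ) ≤ c)
    {δ M R P e q K : ℝ} (hδ : 0 < δ) (hM : 0 ≤ M) (hK : K = 8 + 11 / (s - 1))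
    (hqd : q = 5 * T / (9 * ε * δ)) (hδ0 : δ ≤ degreeEstimate G ε ω)
    (hδd : ∀ i, degreeEstimate G ε ω ≤ G.degree i) (hT : 36 * ε ≤ 5 * T)
    (hZn : ∀ t i, |ω.2.2.2 t i| ≤ n / 2) (hZR : ∀ t, euclNorm (ω.2.2.2 t) ≤ R)
    (h0 : ∀ t ≤ T, ∀ i, |(deflatedMatrix G ^ t).mulVec ω.2.2.1 i| ≤ M * μ 0 ^ t)
    (hq : T * K * R * q * 4 ≤ 1) {i : Fin n}
    (hP : ∀ t : Fin T, |(deflatedMatrix G ^ (T - (t + 1))).mulVec (ω.2.2.2 t) i|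
      ≤ P * μ 0 ^ (T - (t + 1)))
    (he : |(deflatedMatrix G ^ T).mulVec ω.2.2.1 i - v.repr ω.2.2.1 0 * μ 0 ^ T * v 0 i|
      ≤ e * μ 0 ^ T)
    (ha : e + T * q * M * P * 4 < |v.repr ω.2.2.1 0 * v 0 i|) :
    |noiseCoeff G ε c ω μ v 0 * v 0 i
        + ∑ j ∈ Finset.univ.erase (0 : Fin n), finalCoeff G ε c ω μ v j * v j i|
      < |initCoeff ω v 0 * μ 0 ^ T * v 0 i| ∧
    iterates G ε c ω T i = ∑ j, finalCoeff G ε c ω μ v j * v j i ∧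
    SignType.sign (iterates G ε c ω T i)
      = SignType.sign (initCoeff ω v 0) * SignType.sign (v 0 i) := by
  have hs := h.one_lt
  have hl := h.mu_zero_pos
  have hl2 : 1 / 2 ≤ μ 0 := by linarith [h.le_two_mu_zero]
  have hK0 : 0 ≤ K := by
    have : 0 < s - 1 := by linarith
    rw [hK]; positivity
  have hδe : 0 < degreeEstimate G ε ω := hδ.trans_le hδ0
  have hq0 : 0 ≤ q := by rw [hqd]; positivity
  set D := deflatedMatrix G with hD
  set X := iterates G ε c ω with hX
  let Z : ℕ → Fin n → ℝ := fun t => if ht : t < T then ω.2.2.2 ⟨t, ht⟩ else 0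
  let C : ℕ → ℝ := fun t => noiseScale G ε ω (X t)
  have hZ : ∀ t : Fin T, Z t = ω.2.2.2 t := fun t => dif_pos t.2
  have hnoise : ∀ t : Fin T, noise G ε c ω t = C t • Z t := by
    intro t
    ext k
    rw [hZ]
    rfl
  have hrec : ∀ t < T, X (t + 1) = D.mulVec (X t) + C t • Z t := by
    intro t ht
    have := iterates_succ hε hd hc hδe hδd hT hZn ⟨t, ht⟩
    rw [hnoise] at this
    exact this
  have hC : ∀ t M', (∀ i, |X t i| ≤ M') → C t ≤ q * M' := fun t M' hM' => by
    rw [hqd]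
    exact noiseScale_le hε hδ hδ0 hM'
  have hbound : ∀ {t : ℕ}, t ≤ T → ∀ i, |X t i| ≤ 2 * M * μ 0 ^ t := fun {t} ht i =>
    abs_le_of_recursion (K := K) (R := R) (q := q) hK0 hl hM hrec
      (fun k x i => by rw [hK, hD, deflatedMatrix_eq]; exact h.abs_deflatedOf_pow_le k i) h0
      (fun t ht => by rw [hZ ⟨t, ht⟩]; exact hZR _)
      (fun t => noiseScale_nonneg hε hδe _) hC (by linarith) ht i
  have hsum := h.sum_finalCoeff (ε := ε) (c := c) (ω := ω) i
  have hXT : X T i = ∑ j, finalCoeff G ε c ω μ v j * v j i := by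
    rw [hsum, eq_sum_of_recursion hrec le_rfl, Finset.sum_range, Pi.add_apply, Finset.sum_apply]
    congr 1
    refine Finset.sum_congr rfl fun t _ => ?_
    rw [hnoise, Matrix.mulVec_smul]
  -- The constant `4` is `2 * 2`: one factor from the bound `2 * M` on the iterates, one from `1 ≤ 2
  -- * μ 0`, which raises the exponent `T - 1` to `T`.
  have hnoise_le : |∑ t : Fin T, (D ^ (T - (t + 1))).mulVec (noise G ε c ω t) i|
      ≤ T * q * M * P * 4 * μ 0 ^ T := by
    have h1 : ∀ t ∈ (Finset.univ : Finset (Fin T)),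
        |(D ^ (T - (t + 1))).mulVec (noise G ε c ω t) i| ≤ q * M * P * 4 * μ 0 ^ T := by
      intro t _
      have ht := t.2
      have h2 := hC t _ (hbound ht.le)
      have h3 := hP t
      have hC0 : 0 ≤ C t := noiseScale_nonneg hε hδe _
      have hP0 : 0 ≤ P * μ 0 ^ (T - ((t : ℕ) + 1)) := (abs_nonneg _).trans h3
      have hP1 : 0 ≤ P := nonneg_of_mul_nonneg_left hP0 (by positivity)
      rw [hnoise, Matrix.mulVec_smul, hZ, Pi.smul_apply, smul_eq_mul, abs_mul, abs_of_nonneg hC0]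
      calc _ ≤ q * (2 * M * μ 0 ^ (t : ℕ)) * (P * μ 0 ^ (T - ((t : ℕ) + 1))) :=
            mul_le_mul h2 h3 (abs_nonneg _) (hC0.trans h2)
        _ = q * M * P * 4 * ((1 / 2) * μ 0 ^ (t + (T - ((t : ℕ) + 1)))) := by rw [pow_add]; ring
        _ ≤ q * M * P * 4 * (μ 0 * μ 0 ^ (t + (T - ((t : ℕ) + 1)))) := by gcongr
        _ = _ := by rw [← pow_succ', show (t : ℕ) + (T - (t + 1)) + 1 = T by omega]
    refine (Finset.abs_sum_le_sum_abs _ _).trans ((Finset.sum_le_sum h1).trans (le_of_eq ?_))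
    rw [Finset.sum_const, Finset.card_univ, Fintype.card_fin, nsmul_eq_mul]
    ring
  set m := initCoeff ω v 0 * μ 0 ^ T * v 0 i with hm
  set r := noiseCoeff G ε c ω μ v 0 * v 0 i
        + ∑ j ∈ Finset.univ.erase (0 : Fin n), finalCoeff G ε c ω μ v j * v j i with hr
  have hsplit : ∑ j, finalCoeff G ε c ω μ v j * v j i = m + r := by
    rw [← Finset.add_sum_erase _ _ (Finset.mem_univ (0 : Fin n)), hm, hr, finalCoeff]
    ring
  have hpow : 0 < μ 0 ^ T := by positivity
  have hlt : |r| < |m| := by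
    have h1 : r = ((D ^ T).mulVec ω.2.2.1 i - v.repr ω.2.2.1 0 * μ 0 ^ T * v 0 i)
        + ∑ t : Fin T, (D ^ (T - (t + 1))).mulVec (noise G ε c ω t) i := by
      have : r = (m + r) - m := by ring
      rw [this, ← hsplit, hsum, hm, initCoeff]
      ring
    have h2 : |m| = |v.repr ω.2.2.1 0 * v 0 i| * μ 0 ^ T := by
      rw [← abs_of_pos hpow, ← abs_mul, hm, initCoeff]
      congr 1
      ring
    rw [h1, h2]
    refine (abs_add_le _ _).trans_lt ?_
    have := mul_lt_mul_of_pos_right ha hpow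
    linarith
  refine ⟨hlt, hXT, ?_⟩
  rw [hXT, hsplit]
  have hsign : SignType.sign m = SignType.sign (initCoeff ω v 0) * SignType.sign (v 0 i) := by
    rw [hm, sign_mul, sign_mul, sign_pos hpow, mul_one]
  rw [← hsign]
  rcases lt_trichotomy m 0 with h1 | h1 | h1
  · rw [sign_neg h1, sign_neg]
    rw [abs_of_neg h1] at hlt
    linarith [le_abs_self r]
  · rw [h1, abs_zero] at hlt
    exact absurd hlt (not_lt.2 (abs_nonneg r))
  · rw [sign_pos h1, sign_pos]
    rw [abs_of_pos h1] at hlt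
    linarith [neg_abs_le r]

end Run

/-! ### Probability bounds for the sample -/

section Sample

variable {n T : ℕ} {ε : ℝ}

lemma isProbabilityMeasure_sampleLaw (hε : 0 < ε) : IsProbabilityMeasure (sampleLaw ε n T) := by
  have := isProbabilityMeasure_laplace (b := 10 / ε) (by positivity)
  rw [sampleLaw]
  infer_instance

/-- The inequality, unlike equality, holds for arbitrary sets, so measurability of the bad events
never has to be checked. -/
lemma measure_setOf_mem_le {α β : Type*} [MeasurableSpace α] [MeasurableSpace β] {P : Measure α}
    {Q : Measure β} {f : α → β} (hf : MeasurePreserving f P Q) (A : Set β) :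
    P {a | f a ∈ A} ≤ Q A := by
  rw [← hf.map_eq]
  exact Measure.le_map_apply hf.measurable.aemeasurable A

lemma sampleLaw_degreeNoise_le (hε : 0 < ε) (i : Fin n) (A : Set ℝ) :
    sampleLaw ε n T {ω | ω.1 i ∈ A} ≤ laplace (10 / ε) A := by
  have := isProbabilityMeasure_laplace (b := 10 / ε) (by positivity)
  have h1 : MeasurePreserving (fun ω : Sample n T => ω.1) (sampleLaw ε n T) _ :=
    measurePreserving_fst
  exact measure_setOf_mem_le
    ((measurePreserving_eval (fun _ : Fin n => laplace (10 / ε)) i).comp h1) A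

lemma sampleLaw_init_le (hε : 0 < ε) (A : Set (Fin n → ℝ)) :
    sampleLaw ε n T {ω | ω.2.2.1 ∈ A} ≤ Measure.pi (fun _ : Fin n => gaussianReal 0 1) A := by
  have := isProbabilityMeasure_laplace (b := 10 / ε) (by positivity)
  have h1 : MeasurePreserving (fun ω : Sample n T => ω.2) (sampleLaw ε n T) _ :=
    measurePreserving_snd
  exact measure_setOf_mem_le (measurePreserving_fst.comp (measurePreserving_snd.comp h1)) A

lemma sampleLaw_noise_le (hε : 0 < ε) (t : Fin T) (A : Set (Fin n → ℝ)) :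
    sampleLaw ε n T {ω | ω.2.2.2 t ∈ A} ≤ Measure.pi (fun _ : Fin n => laplace 1) A := by
  have := isProbabilityMeasure_laplace (b := 10 / ε) (by positivity)
  have h1 : MeasurePreserving (fun ω : Sample n T => ω.2) (sampleLaw ε n T) _ :=
    measurePreserving_snd
  exact measure_setOf_mem_le ((measurePreserving_eval
    (fun _ : Fin T => Measure.pi fun _ : Fin n => laplace 1) t).comp
      (measurePreserving_snd.comp (measurePreserving_snd.comp h1))) A

lemma one_sub_le_measureReal {α : Type*} [MeasurableSpace α] {P : Measure α}
    [IsProbabilityMeasure P] {S bad : Set α} (h : badᶜ ⊆ S) {a : ℝ} (ha : 0 ≤ a)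
    (hbad : P bad ≤ ENNReal.ofReal a) : 1 - a ≤ P.real S := by
  have h1 : P.real Set.univ ≤ P.real bad + P.real S := by
    refine (measureReal_mono (Set.univ_subset_iff.2 ?_)).trans (measureReal_union_le bad S)
    rw [Set.eq_univ_iff_forall]
    intro x
    by_cases hx : x ∈ bad
    · exact Or.inl hx
    · exact Or.inr (h hx)
  have h2 : P.real bad ≤ a := ENNReal.toReal_le_of_le_ofReal ha hbad
  rw [probReal_univ] at h1
  linarith

lemma measure_iUnion_le_ofReal {α ι : Type*} [MeasurableSpace α] {P : Measure α} [Fintype ι]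
    {A : ι → Set α} {a : ℝ} (hA : ∀ i, P (A i) ≤ ENNReal.ofReal a) :
    P (⋃ i, A i) ≤ ENNReal.ofReal (Fintype.card ι * a) := by
  refine (measure_iUnion_fintype_le P A).trans ((Finset.sum_le_sum fun i _ => hA i).trans ?_)
  rw [Finset.sum_const, Finset.card_univ, nsmul_eq_mul, ENNReal.ofReal_mul (by positivity),
    ENNReal.ofReal_natCast]

lemma measure_union_le_ofReal {α : Type*} [MeasurableSpace α] {P : Measure α} {A A' : Set α}
    {a a' : ℝ} (ha : 0 ≤ a) (ha' : 0 ≤ a') (hA : P A ≤ ENNReal.ofReal a)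
    (hA' : P A' ≤ ENNReal.ofReal a') : P (A ∪ A') ≤ ENNReal.ofReal (a + a') := by
  rw [ENNReal.ofReal_add ha ha']
  exact (measure_union_le _ _).trans (add_le_add hA hA')

/-- The form is tested on its own coefficient vector. This turns a deterministic bound on an entry
into a bound on the variance of the corresponding random linear form. -/
lemma sum_sq_le_of_abs_le {a : Fin n → ℝ} {σ : ℝ} (hσ : 0 ≤ σ)
    (h : ∀ x : Fin n → ℝ, |∑ k, a k * x k| ≤ σ * euclNorm x) : ∑ k, a k ^ 2 ≤ σ ^ 2 := by
  have h1 := h a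
  have h2 : ∑ k, a k * a k = euclNorm a ^ 2 := by
    rw [euclNorm_sq]
    exact Finset.sum_congr rfl fun k _ => (sq _).symm
  rw [h2, abs_of_nonneg (sq_nonneg _)] at h1
  rw [← euclNorm_sq]
  refine pow_le_pow_left₀ (euclNorm_nonneg a) ?_ 2
  rcases (euclNorm_nonneg a).eq_or_lt with h0 | h0
  · rw [← h0]; exact hσ
  · nlinarith

open Classical in
-- The shift by `S` outweighs the noise, so the estimate never exceeds a true degree and no list is
-- enlarged; the price is at most `2 * S` in the lower bound.
lemma degreeEstimate_bounds [NeZero n] {G : SimpleGraph (Fin n)} {ω : Sample n T} {m S : ℝ}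
    (hS : S = 10 / ε * Real.log ((n : ℝ) / (2 * (1 / (n : ℝ))))) (hm : ∀ i, m ≤ G.degree i)
    (h : ∀ i, |ω.1 i| ≤ S) :
    m - 2 * S ≤ degreeEstimate G ε ω ∧ ∀ i, degreeEstimate G ε ω ≤ G.degree i := by
  rw [degreeEstimate, ← hS]
  constructor
  · have : m - S ≤ ⨅ i : Fin n, ((G.degree i : ℝ) + ω.1 i) :=
      le_ciInf fun i => by linarith [hm i, (abs_le.1 (h i)).1]
    linarith
  · intro i
    have : ⨅ i : Fin n, ((G.degree i : ℝ) + ω.1 i) ≤ G.degree i + ω.1 i :=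
      ciInf_le (Set.finite_range _).bddBelow i
    linarith [(abs_le.1 (h i)).2]

end Sample

/-! ### Tail bounds for the linear forms that occur in a run -/

namespace IsGapped

variable {n T : ℕ} [NeZero n] {G : SimpleGraph (Fin n)} {ε : ℝ}
  {d κ : Fin n → ℝ} {u : Module.Basis (Fin n) ℝ (Fin n → ℝ)}
  {μ : Fin n → ℝ} {v : Module.Basis (Fin n) ℝ (Fin n → ℝ)} {s : ℝ}

/-- The bound for the rows of the normalized powers of the deflated matrix. -/
noncomputable def rowBound (s : ℝ) : ℝ := 8 + 11 / (s - 1)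

lemma rowBound_pos (hs : 1 < s) : 0 < rowBound s := by
  have : 0 < s - 1 := by linarith
  rw [rowBound]
  positivity

lemma sum_row_sq_le (h : IsGapped (transitionMatrix G) d κ u μ v s) (k : ℕ) (i : Fin n) :
    ∑ j, ((deflatedMatrix G ^ k) i j) ^ 2 ≤ (rowBound s * μ 0 ^ k) ^ 2 :=
  sum_sq_le_of_abs_le
    (mul_nonneg (rowBound_pos h.one_lt).le (pow_nonneg h.mu_zero_pos.le k))
    fun _ => h.abs_deflatedOf_pow_le k i

/-- The coordinate functional takes the value `1` on the unit vector `v 0`; Cauchy–Schwarz bounds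
its norm from below. -/
lemma one_le_sum_repr_sq (h : IsGapped (transitionMatrix G) d κ u μ v s) :
    1 ≤ ∑ k, v.repr (Pi.single k 1) 0 ^ 2 := by
  have h1 := repr_eq_sum (v := v) (v 0)
  have h2 := Finset.sum_mul_sq_le_sq_mul_sq Finset.univ
    (fun k => v.repr (Pi.single k 1) 0) fun k => v 0 k
  rw [← h1, h.eigenD.unit, v.repr_self] at h2
  simpa using h2

lemma sampleLaw_coeff_small (h : IsGapped (transitionMatrix G) d κ u μ v s) (hε : 0 < ε) :
    sampleLaw ε n T {ω | |v.repr ω.2.2.1 0| ≤ 1 / 20} ≤ ENNReal.ofReal 0.05 := by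
  have h1 := h.one_le_sum_repr_sq
  have h2 := pi_gaussian_linear_le (fun k => v.repr (Pi.single k 1) 0) (by linarith)
  refine le_trans ?_ ((sampleLaw_init_le (T := T) hε _).trans h2)
  refine measure_mono fun ω hω => ?_
  simp only [Set.mem_ofPred_eq] at hω ⊢
  rw [← repr_eq_sum]
  have : 1 ≤ √(∑ k, v.repr (Pi.single k 1) 0 ^ 2) := Real.one_le_sqrt.2 h1
  linarith

lemma sampleLaw_power_large (h : IsGapped (transitionMatrix G) d κ u μ v s) (hε : 0 < ε)
    (w : ℝ) (t : ℕ) (i : Fin n) :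
    sampleLaw ε n T {ω | rowBound s * μ 0 ^ t * w ≤ |(deflatedMatrix G ^ t).mulVec ω.2.2.1 i|}
      ≤ ENNReal.ofReal (4 * Real.exp (-w)) :=
  (sampleLaw_init_le hε {x | rowBound s * μ 0 ^ t * w ≤ |(deflatedMatrix G ^ t).mulVec x i|}).trans
    (pi_gaussian_linear_ge _ (mul_pos (rowBound_pos h.one_lt) (pow_pos h.mu_zero_pos t))
      (h.sum_row_sq_le t i) w)

lemma sampleLaw_remainder_large (h : IsGapped (transitionMatrix G) d κ u μ v s) (hε : 0 < ε)
    (w : ℝ) (hT : T ≠ 0) (i : Fin n) :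
    sampleLaw ε n T {ω | 4 * (2 + 1 / (s - 1) + T) * (μ 0 / s) ^ T * w
        ≤ |(deflatedMatrix G ^ T).mulVec ω.2.2.1 i - v.repr ω.2.2.1 0 * μ 0 ^ T * v 0 i|}
      ≤ ENNReal.ofReal (4 * Real.exp (-w)) := by
  have hs := h.one_lt
  have hs1 : 0 < s - 1 := by linarith
  have hμ := h.mu_zero_pos
  have hlin : ∀ x : Fin n → ℝ, (deflatedMatrix G ^ T).mulVec x i - v.repr x 0 * μ 0 ^ T * v 0 i
      = ∑ k, ((deflatedMatrix G ^ T) i k - v.repr (Pi.single k 1) 0 * μ 0 ^ T * v 0 i) * x k := by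
    intro x
    rw [repr_eq_sum x]
    simp only [Matrix.mulVec, dotProduct, sub_mul, Finset.sum_sub_distrib, Finset.sum_mul]
    congr 1
    exact Finset.sum_congr rfl fun k _ => by ring
  have h1 := sum_sq_le_of_abs_le (σ := 4 * (2 + 1 / (s - 1) + T) * (μ 0 / s) ^ T) (by positivity)
    fun x => (hlin x) ▸ h.abs_deflatedOf_pow_sub_le (x := x) hT i
  have h2 := pi_gaussian_linear_ge _ (by positivity) h1 w
  simp only [← hlin] at h2
  exact (sampleLaw_init_le hε _).trans h2

lemma sampleLaw_noise_large (h : IsGapped (transitionMatrix G) d κ u μ v s) (hε : 0 < ε)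
    {w : ℝ} (hw : 0 < w) (t : Fin T) (k : ℕ) (i : Fin n) :
    sampleLaw ε n T {ω | rowBound s * w * μ 0 ^ k
        ≤ |(deflatedMatrix G ^ k).mulVec (ω.2.2.2 t) i|}
      ≤ ENNReal.ofReal (2 / w ^ 2) := by
  have hK := rowBound_pos h.one_lt
  have hμ := h.mu_zero_pos
  have h2 := pi_laplace_linear_ge (fun j => (deflatedMatrix G ^ k) i j)
    (u := rowBound s * w * μ 0 ^ k) (by positivity)
  refine (sampleLaw_noise_le hε t _).trans (h2.trans (ENNReal.ofReal_le_ofReal ?_))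
  rw [div_le_div_iff₀ (by positivity) (by positivity)]
  have h3 := h.sum_row_sq_le k i
  calc _ ≤ 2 * (rowBound s * μ 0 ^ k) ^ 2 * w ^ 2 := by gcongr
    _ = _ := by ring

end IsGapped

section Sample

variable {n T : ℕ} {ε : ℝ}

lemma sampleLaw_euclNorm_large (hε : 0 < ε) (hn : 0 < n) {L : ℝ} (hL : 0 < L) (t : Fin T) :
    sampleLaw ε n T {ω | 2 * √n * L < euclNorm (ω.2.2.2 t)}
      ≤ ENNReal.ofReal (1 / L ^ 2) := by
  have hn' : (0 : ℝ) < n := by exact_mod_cast hn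
  have h1 := pi_laplace_sq_ge (n := n) (R := 4 * n * L ^ 2) (by positivity)
  refine le_trans ?_ ((sampleLaw_noise_le (T := T) hε t _).trans
    (h1.trans (ENNReal.ofReal_le_ofReal ?_)))
  · refine measure_mono fun ω hω => ?_
    simp only [Set.mem_ofPred_eq] at hω ⊢
    rw [← euclNorm_sq]
    calc 4 * n * L ^ 2 = (2 * √n * L) ^ 2 := by
          rw [mul_pow, mul_pow, Real.sq_sqrt hn'.le]; ring
      _ ≤ _ := pow_le_pow_left₀ (by positivity) (le_of_lt hω) 2
  · rw [div_le_div_iff₀ (by positivity) (by positivity)]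
    have : 0 ≤ (n : ℝ) * L ^ 2 := by positivity
    nlinarith

lemma sampleLaw_degreeNoise_large (hε : 0 < ε) (hn : 2 ≤ n) (i : Fin n) :
    sampleLaw ε n T {ω | 10 / ε * Real.log ((n : ℝ) / (2 * (1 / (n : ℝ)))) < |ω.1 i|}
      ≤ ENNReal.ofReal (2 / n ^ 2) := by
  have hn' : (2 : ℝ) ≤ n := by exact_mod_cast hn
  have hq : (n : ℝ) / (2 * (1 / (n : ℝ))) = n ^ 2 / 2 := by field_simp
  have h1 : (1 : ℝ) ≤ n ^ 2 / 2 := by nlinarith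
  rw [hq]
  refine (sampleLaw_degreeNoise_le hε i
    {x | 10 / ε * Real.log ((n : ℝ) ^ 2 / 2) < |x|}).trans (le_of_eq ?_)
  rw [laplace_abs_gt (by positivity) (mul_nonneg (by positivity) (Real.log_nonneg h1))]
  congr 1
  have : -(10 / ε * Real.log ((n : ℝ) ^ 2 / 2)) / (10 / ε) = -Real.log ((n : ℝ) ^ 2 / 2) := by
    field_simp
  rw [this, Real.exp_neg, Real.exp_log (by linarith), inv_div]

end Sample

open Classical in
/-- The conclusion of the theorem with explicit error terms. -/
lemma IsGapped.le_sampleLaw_real {n T : ℕ} [NeZero n] {G : SimpleGraph (Fin n)} {ε : ℝ}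
    {d κ : Fin n → ℝ} {u : Module.Basis (Fin n) ℝ (Fin n → ℝ)}
    {μ : Fin n → ℝ} {v : Module.Basis (Fin n) ℝ (Fin n → ℝ)} {s : ℝ} {c : WithTop ℝ}
    (h : IsGapped (transitionMatrix G) d κ u μ v s) (hε : 0 < ε)
    (hc : ((n : ℝ) : WithTop ℝ) ≤ c)
    {γ L a η : ℝ} (hγ : 0 < γ) (hLn : L = Real.log n) (hL : 1 ≤ L)
    (ha : 0 < a) (hη : 0 < η)
    (hdeg : ∀ i, 2 * √(n : ℝ) * L ^ 4 ≤ (G.degree i : ℝ))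
    (hT0 : T ≠ 0) (hT : 36 * ε ≤ 5 * T) (hTa : T ≤ a * L) (hTs : n ≤ s * s ^ T) (hTn : a * L + 1 ≤ n)
    (hL4 : 4 * L ≤ √n) (hεn : 40 / ε ≤ √n) (hind : 40 * rowBound s * a ^ 2 ≤ 9 * ε * L)
    (hrem : 960 * s * (2 + 1 / (s - 1) + a * L) * L ≤ γ * √n)
    (hηγ : 4800 * rowBound s ^ 2 * η * a ^ 2 ≤ 9 * ε * γ)
    {i : Fin n} (hi : γ / √(n : ℝ) ≤ |v 0 i|) :
    0.95 - (10 / n + (a + 2 * a / η ^ 2) / L) ≤ (sampleLaw ε n T).real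
      {ω | |noiseCoeff G ε c ω μ v 0 * v 0 i
              + ∑ j ∈ Finset.univ.erase (0 : Fin n), finalCoeff G ε c ω μ v j * v j i|
            < |initCoeff ω v 0 * μ 0 ^ T * v 0 i| ∧
          iterates G ε c ω T i = ∑ j, finalCoeff G ε c ω μ v j * v j i ∧
          SignType.sign (iterates G ε c ω T i)
            = SignType.sign (initCoeff ω v 0) * SignType.sign (v 0 i)} := by
  have hprob := isProbabilityMeasure_sampleLaw (n := n) (T := T) hε
  have hs := h.one_lt
  have hs1 : 0 < s - 1 := by linarith
  have hμ := h.mu_zero_pos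
  have hK := rowBound_pos hs
  have hL0 : 0 < L := by linarith
  have hn2 := h.two_le
  have hn : (0 : ℝ) < n := by exact_mod_cast (by omega : 0 < n)
  have hn1 : (1 : ℝ) ≤ n := by exact_mod_cast (by omega : 1 ≤ n)
  have hsn : 0 < √(n : ℝ) := Real.sqrt_pos.2 hn
  have hsnn : √(n : ℝ) * √n = n := Real.mul_self_sqrt hn.le
  -- The Gaussian threshold is `3 * L` because `A3` is a union of `(T + 1) * n ≤ n ^ 2` events, each
  -- of probability at most `4 / n ^ 3`.
  have hexp : 4 * Real.exp (-(3 * L)) = 4 / n ^ 3 := by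
    rw [Real.exp_neg, show 3 * L = ((3 : ℕ) : ℝ) * L by norm_num, Real.exp_nat_mul, hLn,
      Real.exp_log hn]
    ring
  set S := 10 / ε * Real.log ((n : ℝ) / (2 * (1 / (n : ℝ)))) with hS
  let A1 : Set (Sample n T) := ⋃ k : Fin n, {ω | S < |ω.1 k|}
  let A2 : Set (Sample n T) := {ω | |v.repr ω.2.2.1 0| ≤ 1 / 20}
  let A3 : Set (Sample n T) := ⋃ p : Fin (T + 1) × Fin n,
    {ω | rowBound s * μ 0 ^ (p.1 : ℕ) * (3 * L)
      ≤ |(deflatedMatrix G ^ (p.1 : ℕ)).mulVec ω.2.2.1 p.2|}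
  let A4 : Set (Sample n T) := {ω | 4 * (2 + 1 / (s - 1) + T) * (μ 0 / s) ^ T * (3 * L)
    ≤ |(deflatedMatrix G ^ T).mulVec ω.2.2.1 i - v.repr ω.2.2.1 0 * μ 0 ^ T * v 0 i|}
  let A5 : Set (Sample n T) := ⋃ t : Fin T, {ω | 2 * √n * L < euclNorm (ω.2.2.2 t)}
  let A6 : Set (Sample n T) := ⋃ t : Fin T,
    {ω | rowBound s * (η * L) * μ 0 ^ (T - ((t : ℕ) + 1))
      ≤ |(deflatedMatrix G ^ (T - ((t : ℕ) + 1))).mulVec (ω.2.2.2 t) i|}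
  have hA1 : sampleLaw ε n T A1 ≤ ENNReal.ofReal (2 / n) := by
    refine (measure_iUnion_le_ofReal fun k => sampleLaw_degreeNoise_large hε hn2 k).trans
      (ENNReal.ofReal_le_ofReal (le_of_eq ?_))
    rw [Fintype.card_fin]
    field_simp
  have hA2 : sampleLaw ε n T A2 ≤ ENNReal.ofReal 0.05 := h.sampleLaw_coeff_small hε
  have hA3 : sampleLaw ε n T A3 ≤ ENNReal.ofReal (4 / n) := by
    refine (measure_iUnion_le_ofReal fun p : Fin (T + 1) × Fin n =>
      h.sampleLaw_power_large hε (3 * L) p.1 p.2).trans (ENNReal.ofReal_le_ofReal ?_)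
    rw [hexp, Fintype.card_prod, Fintype.card_fin, Fintype.card_fin]
    push_cast
    calc ((T : ℝ) + 1) * n * (4 / n ^ 3) ≤ n * n * (4 / n ^ 3) := by
          gcongr
          linarith
      _ = _ := by field_simp
  have hA4 : sampleLaw ε n T A4 ≤ ENNReal.ofReal (4 / n) := by
    refine (h.sampleLaw_remainder_large hε (3 * L) hT0 i).trans (ENNReal.ofReal_le_ofReal ?_)
    rw [hexp]
    exact div_le_div_of_nonneg_left (by norm_num) hn (le_self_pow₀ hn1 (by norm_num))
  have hA5 : sampleLaw ε n T A5 ≤ ENNReal.ofReal (a / L) := by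
    refine (measure_iUnion_le_ofReal fun t : Fin T =>
      sampleLaw_euclNorm_large hε (by omega) hL0 t).trans (ENNReal.ofReal_le_ofReal ?_)
    rw [Fintype.card_fin]
    calc (T : ℝ) * (1 / L ^ 2) ≤ a * L * (1 / L ^ 2) := by gcongr
      _ = _ := by field_simp
  have hA6 : sampleLaw ε n T A6 ≤ ENNReal.ofReal (2 * a / η ^ 2 / L) := by
    refine (measure_iUnion_le_ofReal fun t : Fin T =>
      h.sampleLaw_noise_large hε (w := η * L) (by positivity) t _ i).trans
        (ENNReal.ofReal_le_ofReal ?_)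
    rw [Fintype.card_fin]
    calc (T : ℝ) * (2 / (η * L) ^ 2) ≤ a * L * (2 / (η * L) ^ 2) := by gcongr
      _ = _ := by field_simp
  have hbad : sampleLaw ε n T (A1 ∪ A2 ∪ A3 ∪ A4 ∪ A5 ∪ A6)
      ≤ ENNReal.ofReal (2 / n + 0.05 + 4 / n + 4 / n + a / L + 2 * a / η ^ 2 / L) := by
    refine measure_union_le_ofReal (by positivity) (by positivity) ?_ hA6
    refine measure_union_le_ofReal (by positivity) (by positivity) ?_ hA5
    refine measure_union_le_ofReal (by positivity) (by positivity) ?_ hA4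
    refine measure_union_le_ofReal (by positivity) (by positivity) ?_ hA3
    exact measure_union_le_ofReal (by positivity) (by positivity) hA1 hA2
  have htotal : 0.95 - (10 / n + (a + 2 * a / η ^ 2) / L)
      = 1 - (2 / n + 0.05 + 4 / n + 4 / n + a / L + 2 * a / η ^ 2 / L) := by ring
  rw [htotal]
  refine one_sub_le_measureReal (fun ω hω => ?_) (by positivity) hbad
  simp only [Set.mem_compl_iff, Set.mem_union, not_or] at hω
  obtain ⟨⟨⟨⟨⟨h1, h2⟩, h3⟩, h4⟩, h5⟩, h6⟩ := hω
  simp only [A1, A2, A3, A4, A5, A6, Set.mem_iUnion, Set.mem_ofPred_eq, not_exists, not_lt, not_le]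
    at h1 h2 h3 h4 h5 h6
  have hdeg0 : ∀ i, 0 < G.degree i := fun i => by
    have h7 : (0 : ℝ) < G.degree i := lt_of_lt_of_le (by positivity) (hdeg i)
    exact_mod_cast h7
  -- The correction uses up at most half of the minimum degree, which leaves the lower bound `√n * L
  -- ^ 4` for the estimate.
  have hSL : 2 * S ≤ √n * L ^ 4 := by
    have hq : (n : ℝ) / (2 * (1 / (n : ℝ))) = n ^ 2 / 2 := by field_simp
    have h7 : Real.log ((n : ℝ) ^ 2 / 2) ≤ 2 * L := by
      rw [Real.log_div (by positivity) two_ne_zero, Real.log_pow, ← hLn]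
      have := Real.log_nonneg (x := 2) (by norm_num)
      push_cast
      linarith
    have h8 : L ≤ L ^ 4 := le_self_pow₀ hL (by norm_num)
    calc 2 * S = 20 / ε * Real.log ((n : ℝ) ^ 2 / 2) := by rw [hS, hq]; ring
      _ ≤ 20 / ε * (2 * L) := by gcongr
      _ = 40 / ε * L := by ring
      _ ≤ √n * L ^ 4 := by gcongr
  have hδ := degreeEstimate_bounds hS hdeg h1
  have hR : ∀ t, euclNorm (ω.2.2.2 t) ≤ 2 * √n * L := h5
  have hT2 : (T : ℝ) ^ 2 ≤ (a * L) ^ 2 := pow_le_pow_left₀ (by positivity) hTa 2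
  refine h.run (δ := √n * L ^ 4) (M := rowBound s * (3 * L)) (R := 2 * √n * L)
    (P := rowBound s * (η * L)) (K := rowBound s)
    (e := 4 * (2 + 1 / (s - 1) + T) / s ^ T * (3 * L))
    hε hdeg0 hc (by positivity) (by positivity) rfl rfl (by linarith [hδ.1]) hδ.2 hT
    (fun t k => ?_) hR (fun t ht k => ?_) ?_ (fun t => (h6 t).le) ?_ ?_
  · calc |ω.2.2.2 t k| ≤ 2 * √n * L := (abs_le_euclNorm _ k).trans (hR t)
      _ = √n * (4 * L) / 2 := by ring
      _ ≤ √n * √n / 2 := by gcongr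
      _ = n / 2 := by rw [hsnn]
  · have := h3 (⟨t, by omega⟩, k)
    simp only at this
    linarith
  · calc (T : ℝ) * rowBound s * (2 * √n * L) * (5 * T / (9 * ε * (√n * L ^ 4))) * 4
        = 40 * rowBound s * T ^ 2 / (9 * ε * L ^ 3) := by field_simp; ring
      _ ≤ 40 * rowBound s * (a * L) ^ 2 / (9 * ε * L ^ 3) := by gcongr
      _ = 40 * rowBound s * a ^ 2 / (9 * ε * L) := by field_simp
      _ ≤ 1 := by
        rw [div_le_one (by positivity)]
        exact hind
  · refine h4.le.trans (le_of_eq ?_)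
    rw [div_pow]
    ring
  -- The signal exceeds `γ / (20 √n)`; the remainder of `x 0` and the accumulated noise each receive
  -- a quarter of that.
  · have e1 : 4 * (2 + 1 / (s - 1) + T) / s ^ T * (3 * L) ≤ γ / (80 * √n) := by
      have hsT : 0 < s ^ T := by positivity
      calc _ ≤ 4 * (2 + 1 / (s - 1) + a * L) / s ^ T * (3 * L) := by gcongr
        _ = 960 * s * (2 + 1 / (s - 1) + a * L) * L / (80 * (s * s ^ T)) := by field_simp; ring
        _ ≤ γ * √n / (80 * n) := by gcongr
        _ = γ / (80 * √n) := by
          rw [div_eq_div_iff (by positivity) (by positivity)]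
          linear_combination (80 * γ) * hsnn
    have e2 : (T : ℝ) * (5 * T / (9 * ε * (√n * L ^ 4))) * (rowBound s * (3 * L))
        * (rowBound s * (η * L)) * 4 ≤ γ / (80 * √n) := by
      calc _ = 60 * rowBound s ^ 2 * η * T ^ 2 / (9 * ε * √n * L ^ 2) := by field_simp; ring
        _ ≤ 60 * rowBound s ^ 2 * η * (a * L) ^ 2 / (9 * ε * √n * L ^ 2) := by gcongr
        _ = 4800 * rowBound s ^ 2 * η * a ^ 2 / (80 * (9 * ε * √n)) := by field_simp; ring
        _ ≤ 9 * ε * γ / (80 * (9 * ε * √n)) := by gcongr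
        _ = _ := by field_simp
    have e3 : 1 / 20 * (γ / √n) < |v.repr ω.2.2.1 0 * v 0 i| := by
      rw [abs_mul]
      have : 0 < γ / √(n : ℝ) := by positivity
      exact mul_lt_mul h2 hi this (abs_nonneg _)
    have e4 : γ / (80 * √n) = 1 / 80 * (γ / √n) := by field_simp
    have : 0 < γ / √(n : ℝ) := by positivity
    linarith

/-! ### Choice of parameters and conclusion -/

lemma eventually_gap_card {s : ℝ} (hs : 1 < s) :
    ∀ᶠ n : ℕ in atTop, s * (s ^ 2 + ((n : ℝ) - 2)) ≤ s ^ 2 * (n - 2) := by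
  filter_upwards [tendsto_natCast_atTop_atTop.eventually_ge_atTop (s ^ 2 / (s - 1) + 2)] with n hn
  have hs1 : 0 < s - 1 := by linarith
  have h1 : s ^ 2 / (s - 1) ≤ n - 2 := by linarith
  rw [div_le_iff₀ hs1] at h1
  nlinarith

lemma eventually_mul_log_sq_le {Q : ℝ} (hQ : 0 < Q) :
    ∀ᶠ n : ℕ in atTop, Q * Real.log n ^ 2 ≤ √n := by
  have h := (Real.isLittleO_pow_log_id_atTop (n := 4)).bound (c := 1 / Q ^ 2) (by positivity)
  filter_upwards [tendsto_natCast_atTop_atTop.eventually h] with n hn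
  refine Real.le_sqrt_of_sq_le ?_
  simp only [id, Real.norm_eq_abs, Nat.abs_cast] at hn
  rw [abs_of_nonneg (Even.pow_nonneg (by decide) _)] at hn
  calc (Q * Real.log n ^ 2) ^ 2 = Q ^ 2 * Real.log n ^ 4 := by ring
    _ ≤ Q ^ 2 * (1 / Q ^ 2 * n) := by gcongr
    _ = n := by field_simp

/-- The parameters of the union bound are admissible if `L = log n` is large. -/
lemma parameters_admissible {ε g γ s K a q L N T : ℝ} (hε : 0 < ε) (hg : 1 < g) (hγ : 0 < γ)
    (hs : 1 < s) (hK : 0 < K) (ha : a = 3 / Real.log g)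
    (hq : q = 960 * s * (2 + 1 / (s - 1) + a) / γ)
    (hsq : (q + 4 + (a + 1) + 40 / ε) * L ^ 2 ≤ N)
    (hL : 1 + Real.log g + 8 * ε * Real.log g + 40 * K * a ^ 2 / (9 * ε) ≤ L)
    (hT : |T - 2 * L / Real.log g| < 1) :
    1 ≤ L ∧ 0 < T ∧ 36 * ε ≤ 5 * T ∧ T ≤ a * L ∧ 2 * L ≤ (T + 1) * Real.log g ∧ a * L + 1 ≤ N ∧
      4 * L ≤ N ∧ 40 / ε ≤ N ∧ 40 * K * a ^ 2 ≤ 9 * ε * L ∧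
      960 * s * (2 + 1 / (s - 1) + a * L) * L ≤ γ * N := by
  have hs1 : 0 < s - 1 := by linarith
  have hlg : 0 < Real.log g := Real.log_pos hg
  have ha0 : 0 < a := by rw [ha]; positivity
  have hq0 : 0 < q := by rw [hq]; positivity
  have hp1 : 0 < 8 * ε * Real.log g := by positivity
  have hp2 : 0 < 40 * K * a ^ 2 / (9 * ε) := by positivity
  have hL1 : 1 ≤ L := by linarith
  have hL2 : L ≤ L ^ 2 := le_self_pow₀ hL1 (by norm_num)
  have hL3 : 1 ≤ L ^ 2 := hL1.trans hL2
  have hεp : 0 < 40 / ε := by positivity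
  have hb1 : 0 ≤ q * L ^ 2 := by positivity
  have hb2 : 0 ≤ a * L ^ 2 := by positivity
  have hb3 : 40 / ε ≤ 40 / ε * L ^ 2 := le_mul_of_one_le_right hεp.le hL3
  have hb4 : a * L ≤ a * L ^ 2 := mul_le_mul_of_nonneg_left hL2 ha0.le
  have hsum : q * L ^ 2 + 4 * L ^ 2 + a * L ^ 2 + L ^ 2 + 40 / ε * L ^ 2 ≤ N := by linarith
  have hLlg : 1 ≤ L / Real.log g := by
    rw [le_div_iff₀ hlg]
    linarith
  obtain ⟨hTl, hTu⟩ := abs_lt.1 hT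
  have hTe : 2 * L / Real.log g = 2 * (L / Real.log g) := by ring
  rw [hTe] at hTl hTu
  have h8 : 8 * ε ≤ L / Real.log g := by
    rw [le_div_iff₀ hlg]
    linarith
  -- The factor `3` in `a` leaves room for rounding: `T < 2L / log g + 1`, and `L / log g ≥ 1`.
  have haL : a * L = 3 * (L / Real.log g) := by rw [ha]; ring
  refine ⟨hL1, by linarith, by linarith, by linarith, ?_, by linarith, by linarith, by linarith,
    ?_, ?_⟩
  · have h1 : 2 * (L / Real.log g) ≤ T + 1 := by linarith
    calc 2 * L = 2 * (L / Real.log g) * Real.log g := by field_simp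
      _ ≤ _ := mul_le_mul_of_nonneg_right h1 hlg.le
  · have h1 : 40 * K * a ^ 2 / (9 * ε) ≤ L := by linarith
    rw [div_le_iff₀ (by positivity)] at h1
    linarith
  · have h0 : 0 < 1 / (s - 1) := by positivity
    have h2 : 2 + 1 / (s - 1) + a * L ≤ (2 + 1 / (s - 1) + a) * L := by nlinarith
    calc 960 * s * (2 + 1 / (s - 1) + a * L) * L
        ≤ 960 * s * ((2 + 1 / (s - 1) + a) * L) * L := by gcongr
      _ = γ * (q * L ^ 2) := by rw [hq]; field_simp
      _ ≤ γ * N := mul_le_mul_of_nonneg_left (by linarith) hγ.le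

open Classical in
lemma isGapped_transitionMatrix {n : ℕ} [NeZero n] {G : SimpleGraph (Fin n)} {κ μ : Fin n → ℝ}
    {u v : Module.Basis (Fin n) ℝ (Fin n → ℝ)} {s : ℝ} (hs : 1 < s) (hn : 2 ≤ n)
    (hdeg : ∀ i, √(n : ℝ) ≤ G.degree i)
    (hu : IsEigenbasis (transitionMatrix G) κ u) (hv : IsEigenbasis (deflatedMatrix G) μ v)
    (hgap : ∀ j : Fin n, 2 ≤ (j : ℕ) → κ j + 1 ≤ (κ 1 + 1) / s ^ 2)
    (hcard : s * (s ^ 2 + ((n : ℝ) - 2)) ≤ s ^ 2 * (n - 2)) :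
    IsGapped (transitionMatrix G) (fun i => (G.degree i : ℝ)) κ u μ v s := by
  have hn0 : (0 : ℝ) < n := by exact_mod_cast (by omega : 0 < n)
  refine ⟨isReversible_transitionMatrix G fun i => ?_, hu, hv, hs, hgap, hcard, hn, fun i => ?_⟩
  · have := (Real.sqrt_pos.2 hn0).trans_le (hdeg i)
    exact_mod_cast this
  · exact (Real.sqrt_le_left (by positivity)).1 (hdeg i)

end PrivatePIC

open Classical in
theorem mainTheorem1 (ε g γ ρ : ℝ) (hε : 0 < ε) (hg : 1 < g) (hγ0 : 0 < γ) (hγ1 : γ < 1)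
    (hρ0 : 0 < ρ) (hρ1 : ρ ≤ 1) :
    ∃ (C : ℕ) (r : ℕ → ℝ), Tendsto r atTop (𝓝 0) ∧
      ∀ (n : ℕ) [NeZero n], C ≤ n →
      ∀ (G : SimpleGraph (Fin n)) (T : ℕ) (c : WithTop ℝ)
        (κ : Fin n → ℝ) (u : Module.Basis (Fin n) ℝ (Fin n → ℝ))
        (μ : Fin n → ℝ) (v : Module.Basis (Fin n) ℝ (Fin n → ℝ)),
        -- number of iterations: `2 log n / log g`, rounded up or down
        |(T : ℝ) - 2 * Real.log n / Real.log g| < 1 →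
        -- clipping factor in `[n, ∞]`
        ((n : ℝ) : WithTop ℝ) ≤ c →
        -- eigenvalues and eigenvectors of `B` and of `W̃`
        PrivatePIC.IsEigenbasis (PrivatePIC.transitionMatrix G) κ u →
        PrivatePIC.IsEigenbasis (PrivatePIC.deflatedMatrix G) μ v →
        -- (1) minimum degree
        (∀ i, 2 * √(n : ℝ) * Real.log n ^ 4 ≤ (G.degree i : ℝ)) →
        -- (2) spectral gap
        (∀ j : Fin n, 2 ≤ (j : ℕ) → κ j + 1 ≤ (κ 1 + 1) / g) →
        -- (3) most entries of the second eigenvector of `B` are not small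
        ρ * n ≤ ((Finset.univ.filter fun i : Fin n => γ / √(n : ℝ) ≤ |u 1 i|).card : ℝ) →
        (∑ k, u 1 k = 0 → v 0 = u 1 ∨ v 0 = -u 1) ∧
        ∀ i : Fin n, γ / √(n : ℝ) ≤ |v 0 i| →
          0.95 - r n ≤ (PrivatePIC.sampleLaw ε n T).real
            {ω | |PrivatePIC.noiseCoeff G ε c ω μ v 0 * v 0 i
                    + ∑ j ∈ Finset.univ.erase (0 : Fin n),
                        PrivatePIC.finalCoeff G ε c ω μ v j * v j i|
                  < |PrivatePIC.initCoeff ω v 0 * μ 0 ^ T * v 0 i| ∧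
                PrivatePIC.iterates G ε c ω T i
                  = ∑ j, PrivatePIC.finalCoeff G ε c ω μ v j * v j i ∧
                SignType.sign (PrivatePIC.iterates G ε c ω T i)
                  = SignType.sign (PrivatePIC.initCoeff ω v 0) * SignType.sign (v 0 i)} := by
  -- The gap is split as `g = s * s`: one factor is spent on the trace argument and on passing to
  -- entrywise bounds, the other gives the decay `s ^ (-T)`.
  obtain ⟨s, hs, hsg⟩ : ∃ s : ℝ, 1 < s ∧ s ^ 2 = g :=
    ⟨√g, Real.lt_sqrt_of_sq_lt (by simpa using hg), Real.sq_sqrt (by linarith)⟩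
  have hK := PrivatePIC.IsGapped.rowBound_pos hs
  obtain ⟨a, ha⟩ : ∃ a, a = 3 / Real.log g := ⟨_, rfl⟩
  have ha0 : 0 < a := by rw [ha]; exact div_pos three_pos (Real.log_pos hg)
  -- The Chebyshev constant is the largest that the noise budget allows; it does not depend on `n`,
  -- so the failure probability is still `O(1 / log n)`.
  obtain ⟨η, hη⟩ : ∃ η, η = 9 * ε * γ / (4800 * PrivatePIC.IsGapped.rowBound s ^ 2 * a ^ 2) :=
    ⟨_, rfl⟩
  have hη0 : 0 < η := by rw [hη]; positivity
  obtain ⟨q, hq⟩ : ∃ q, q = 960 * s * (2 + 1 / (s - 1) + a) / γ := ⟨_, rfl⟩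
  have hq0 : 0 < q := by
    have : 0 < s - 1 := by linarith
    rw [hq]; positivity
  have hlog : Tendsto (fun n : ℕ => Real.log n) atTop atTop :=
    Real.tendsto_log_atTop.comp tendsto_natCast_atTop_atTop
  obtain ⟨C, hC⟩ := eventually_atTop.1 ((eventually_ge_atTop 2).and
    ((PrivatePIC.eventually_gap_card hs).and
    ((PrivatePIC.eventually_mul_log_sq_le (Q := q + 4 + (a + 1) + 40 / ε) (by positivity)).and
    (hlog.eventually_ge_atTop (1 + Real.log g + 8 * ε * Real.log g
      + 40 * PrivatePIC.IsGapped.rowBound s * a ^ 2 / (9 * ε))))))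
  refine ⟨C, fun n => 10 / n + (a + 2 * a / η ^ 2) / Real.log n, ?_, ?_⟩
  · have h1 := (tendsto_const_nhds (x := (10 : ℝ))).div_atTop
      (tendsto_natCast_atTop_atTop (R := ℝ))
    have h2 := (tendsto_const_nhds (x := a + 2 * a / η ^ 2)).div_atTop hlog
    simpa using h1.add h2
  intro n _ hn G T c κ u μ v hT hc hu hv hdeg hgap _
  obtain ⟨hn2, hcard, hsq, hL⟩ := hC n hn
  obtain ⟨p1, p2, p3, p4, p5, p6, p7, p8, p9, p10⟩ :=
    PrivatePIC.parameters_admissible hε hg hγ0 hs hK ha hq hsq hL hT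
  have hn0 : (0 : ℝ) < n := by exact_mod_cast (by omega : 0 < n)
  have hsqn : √(n : ℝ) ≤ n := by
    rw [Real.sqrt_le_left hn0.le]
    exact le_self_pow₀ (by exact_mod_cast (by omega : 1 ≤ n)) (by norm_num)
  have hdeg' : ∀ i, √(n : ℝ) ≤ G.degree i := fun i => by
    refine le_trans ?_ (hdeg i)
    have h4 : 1 ≤ Real.log n ^ 4 := one_le_pow₀ p1
    have h5 : 0 ≤ √(n : ℝ) := Real.sqrt_nonneg _
    nlinarith
  have hgapped := PrivatePIC.isGapped_transitionMatrix hs hn2 hdeg' hu hv (by rwa [hsg]) hcard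
  refine ⟨hgapped.basis_zero_eq_or, fun i hi => ?_⟩
  refine hgapped.le_sampleLaw_real hε hc hγ0 rfl p1 ha0 hη0 hdeg ?_ p3 p4 ?_ (p6.trans hsqn) p7 p8
    p9 p10 ?_ hi
  · rintro rfl
    simp at p2
  -- Even rounded down, `T + 1 ≥ 2 log n / log g`, and `log g = 2 log s`; the extra factor `s` pays
  -- for the rounding.
  · rw [← pow_succ', ← Real.log_le_log_iff hn0 (by positivity), Real.log_pow]
    have h1 : Real.log g = 2 * Real.log s := by
      rw [← hsg, Real.log_pow]; norm_num
    rw [h1] at p5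
    push_cast
    linarith
  · rw [hη]
    refine le_of_eq ?_
    field_simp
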